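/- **Setting.** Let $n\ge 2$ and let $(H\Lambda,d)$ be a Hilbert complex of length $n$: real Hilbert spaces $L^2\Lambda^k$ (zero for $k>n$) and closed, densely defined operators $d:L^2\Lambda^k\to L^2\Lambda^{k+1}$ with domain $H\Lambda^k$ and $d\circ d=0$; put $\|a\|_{H\Lambda^k}^2=\|a\|_{L^2\Lambda^k}^2+\|da\|_{L^2\Lambda^{k+1}}^2$. Assume that it is closed (every range $d\,H\Lambda^k$ is closed) and exact at degree $n-1$ (every $v\in H\Lambda^{n-1}$ with $dv=0$ is $d\tau$ for some $\tau\in H\Lambda^{n-2}$). An example to which everything below applies, whenever it is closed and exact at degree $n-1$, is the $L^2$ de Rham complex of an open set $\Omega\subset\mathbb R^n$, with weak exterior derivative and with (weak) essential boundary conditions $\mathrm{tr}\,a=0$ on $\Gamma_k$ for $k$-forms, where $\Gamma_0\supseteq\Gamma_1\supseteq\cdots$ are parts of $\partial\Omega$. Let $W=H\Lambda^{n-2}$, $V=H\Lambda^{n-1}$, and let $Q$ be the orthogonal complement of $\mathcal Z^{*,n}=(d\,H\Lambda^{n-1})^\perp$ in $L^2\Lambda^n$, with the norms of $H\Lambda^{n-2}$,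 $H\Lambda^{n-1}$, $L^2\Lambda^n$. With $L^2$ inner products put $$a(\tau,\kappa)=(\tau,\kappa),\quad b(v,q)=(dv,q),\quad c(\tau,v)=(d\tau,v),\quad e(v,w)=(dv,dw).$$ Let $(\Lambda_h,d)$ be a finite-dimensional subcomplex ($\Lambda_h^k\subset H\Lambda^k$, $d\Lambda_h^k\subset\Lambda_h^{k+1}$) with mimetic operators: a finite cell complex with cochain spaces $C^k$ and coboundary $\delta$, and linear maps $\mathcal R:H\Lambda^k\to C^k$ and $\mathcal I:C^k\to H\Lambda^k$ with range $\mathcal I(C^k)=\Lambda_h^k$, such that $\mathcal R\mathcal I=\mathrm{id}$, $\mathcal R d=\delta\mathcal R$, $d\mathcal I=\mathcal I\delta$; let $\pi_h=\mathcal I\mathcal R$. Put $W_h=\Lambda_h^{n-2}$, $V_h=\Lambda_h^{n-1}$, $Q_h=\Lambda_h^n\cap Q$. For $X\in\{W,V,W_h,V_h\}$ let $Z_X=\{x\in X: dx=0\}$ and let $Z_X^\perp$ be its orthogonal complement in $X$. A *discrete Poincaré constant* is a $c_{Ph}>0$ with $\|x\|_X\le c_{Ph}\|dx\|_{L^2}$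 for all $x\in Z_X^\perp$, for $X=W_h$ and $X=V_h$; a *Poincaré constant* $c_P$ of $(H\Lambda,d)$ is defined in the same way with $X=W$ and $X=V$. Constants $\alpha,\beta,\gamma,\varepsilon$ *satisfy the inf-sup conditions on* $(W_0,V_0,Q_0)$ if (infima and suprema over non-zero elements) $$\inf_{\tau\in Z_{W_0}}\sup_{\kappa\in Z_{W_0}}\frac{a(\tau,\kappa)}{\|\tau\|_W\|\kappa\|_W}\ge\alpha,\qquad \inf_{q\in Q_0}\sup_{v\in V_0}\frac{b(v,q)}{\|v\|_V\|q\|_Q}\ge\beta,$$ $$\inf_{v\in Z_{V_0}}\sup_{\tau\in W_0}\frac{c(\tau,v)}{\|\tau\|_W\|v\|_V}\ge\gamma,\qquad \inf_{v\in Z_{V_0}^\perp}\sup_{w\in Z_{V_0}^\perp}\frac{e(v,w)}{\|v\|_V\|w\|_V}\ge\varepsilon,$$ and the same holds for $a$ and $e$ with the roles of the two arguments exchanged. **Theorem (Discrete well-posedness).** There are universal functions $\alpha_h,\beta_h,\gamma_h,\varepsilon_h,K_h$ and $\alpha,\beta,\gamma,\varepsilon$ from $\mathbb R$ to $\mathbb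 R$, all positive on $(0,\infty)$, such that, for every complex as above: 1. For every subcomplex with mimetic operators as above and every discrete Poincaré constant $c_{Ph}$ of it, the constants $\alpha_h(c_{Ph}),\beta_h(c_{Ph}),\gamma_h(c_{Ph}),\varepsilon_h(c_{Ph})$ satisfy the inf-sup conditions on $(W_h,V_h,Q_h)$; and for all bounded linear forms $f$ on $V$, $g$ on $Q$, $h$ on $W$ there is a unique $(\omega_h,u_h,p_h)\in W_h\times V_h\times Q_h$ with $$\begin{aligned}a(\tau_h,\omega_h)-c(\tau_h,u_h)&=h(\tau_h)&&\forall\tau_h\in W_h,\\ e(v_h,u_h)+c(\omega_h,v_h)+b(v_h,p_h)&=f(v_h)&&\forall v_h\in V_h,\\ b(u_h,q_h)&=g(q_h)&&\forall q_h\in Q_h,\end{aligned}$$ and it satisfies $\|\omega_h\|_W+\|u_h\|_V+\|p_h\|_Q\le K_h(c_{Ph})\,(\|f\|+\|g\|+\|h\|)$. 2. $(H\Lambda,d)$ has a Poincaré constant, and for every Poincaré constant $c_P$ of it, $\alpha(c_P),\beta(c_P),\gamma(c_P),\varepsilon(c_P)$ satisfy the inf-sup conditions on $(W,V,Q)$.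 Whenever $0<c_{Ph}\le c_P$, $$\alpha_h(c_{Ph})>\alpha(c_P)>0,\quad \beta_h(c_{Ph})>\beta(c_P)>0,\quad \gamma_h(c_{Ph})>\gamma(c_P)>0,\quad \varepsilon_h(c_{Ph})>\varepsilon(c_P)>0.$$ 3. If $c_P$ is a Poincaré constant of $(H\Lambda,d)$ and $\|\pi_h a\|_{H\Lambda^k}\le C\|a\|_{H\Lambda^k}$ for all $k$ and $a$, with $C>0$, then $C\,c_P$ is a discrete Poincaré constant. (Poincaré constants may be enlarged, so part 2 with $\max(1,C)\,c_P$ in place of $c_P$ gives lower bounds that depend only on $c_P$ and $C$.) -/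

import Mathlib

universe u

noncomputable section

section DeRham

open MeasureTheory
open scoped ContDiff

/-! ### The weak `L²` de Rham complex -/

/-- Index sets `I = {i₁ < ⋯ < i_k} ⊆ {0, …, n-1}` of the basic forms
`dx_I = dx^{i₁} ∧ ⋯ ∧ dx^{i_k}`. -/
abbrev FormIndex (n k : ℕ) : Type := {I : Finset (Fin n) // I.card = k}

/-- `J \ {j}` for `j ∈ J`. -/
def FormIndex.erase {n k : ℕ} (J : FormIndex n (k + 1)) (j : J.1) : FormIndex n k :=
  ⟨J.1.erase j, by rw [Finset.card_erase_of_mem j.2, J.2]; rfl⟩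

/-- The sign in `dx^j ∧ dx_{J \ {j}} = (-1)^{#{i ∈ J : i < j}} dx_J`. -/
def FormIndex.sign {n k : ℕ} (J : FormIndex n (k + 1)) (j : J.1) : ℝ :=
  (-1) ^ (J.1.filter (fun i => i < (j : Fin n))).card

/-- `L²Λᵏ(Ω)`: forms `a = ∑_I a_I dx_I` with `a_I ∈ L²(Ω)`, with `(a, b)_Ω = ∑_I ∫_Ω a_I b_I`. -/
abbrev L2Form (n k : ℕ) (Ω : Set (EuclideanSpace ℝ (Fin n))) : Type :=
  PiLp 2 (fun _ : FormIndex n k => Lp ℝ 2 (volume.restrict Ω))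

/-- The partial derivative `∂_j φ`. -/
def partialDeriv {n : ℕ} (j : Fin n) (φ : EuclideanSpace ℝ (Fin n) → ℝ) :
    EuclideanSpace ℝ (Fin n) → ℝ :=
  fun x => fderiv ℝ φ x (EuclideanSpace.single j 1)

/-- Smooth compactly supported functions on `ℝⁿ` which vanish near `∂Ω \ Γ`. -/
def IsTestFunction {n : ℕ} (Ω Γ : Set (EuclideanSpace ℝ (Fin n)))
    (φ : EuclideanSpace ℝ (Fin n) → ℝ) : Prop :=
  ContDiff ℝ ∞ φ ∧ HasCompactSupport φ ∧ Disjoint (tsupport φ) (closure (frontier Ω \ Γ))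

/-- `b = d a` weakly in `Ω`, and `tr a = 0` weakly on the part `Γ` of the boundary:
`∫_Ω b_J φ = - ∑_{j ∈ J} ± ∫_Ω a_{J \ {j}} ∂_j φ` for all test functions `φ` that vanish near the
rest of the boundary. For `Γ = ∅` this is the plain weak exterior derivative. -/
def IsWeakExtDeriv {n k : ℕ} (Ω Γ : Set (EuclideanSpace ℝ (Fin n)))
    (a : L2Form n k Ω) (b : L2Form n (k + 1) Ω) : Prop :=
  ∀ (J : FormIndex n (k + 1)) (φ : EuclideanSpace ℝ (Fin n) → ℝ), IsTestFunction Ω Γ φ →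
    ∫ x in Ω, b J x * φ x =
      - ∑ j : J.1, J.sign j * ∫ x in Ω, a (J.erase j) x * partialDeriv (j : Fin n) φ x

theorem partialDeriv_contDiff {n : ℕ} (j : Fin n) {φ : EuclideanSpace ℝ (Fin n) → ℝ}
    (hφ : ContDiff ℝ ∞ φ) : ContDiff ℝ ∞ (partialDeriv j φ) := by
  have h : ContDiff ℝ ∞ (fderiv ℝ φ) := hφ.fderiv_right (by norm_num)
  exact h.clm_apply contDiff_const

theorem partialDeriv_tsupport {n : ℕ} (j : Fin n) (φ : EuclideanSpace ℝ (Fin n) → ℝ) :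
    tsupport (partialDeriv j φ) ⊆ tsupport φ :=
  tsupport_fderiv_apply_subset ℝ _

theorem IsTestFunction.partialDeriv {n : ℕ} {Ω Γ : Set (EuclideanSpace ℝ (Fin n))}
    {φ : EuclideanSpace ℝ (Fin n) → ℝ} (h : IsTestFunction Ω Γ φ) (j : Fin n) :
    IsTestFunction Ω Γ (partialDeriv j φ) :=
  ⟨partialDeriv_contDiff j h.1, h.2.1.of_isClosed_subset (isClosed_tsupport _)
    (partialDeriv_tsupport j φ), h.2.2.mono_left (partialDeriv_tsupport j φ)⟩

theorem IsTestFunction.mono {n : ℕ} {Ω Γ Γ' : Set (EuclideanSpace ℝ (Fin n))}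
    {φ : EuclideanSpace ℝ (Fin n) → ℝ} (h : IsTestFunction Ω Γ φ) (hΓ : Γ ⊆ Γ') :
    IsTestFunction Ω Γ' φ :=
  ⟨h.1, h.2.1, h.2.2.mono_right (closure_mono (Set.sdiff_subset_sdiff_right hΓ))⟩

theorem IsTestFunction.of_tsupport {n : ℕ} {Ω : Set (EuclideanSpace ℝ (Fin n))} (hΩ : IsOpen Ω)
    (Γ : Set (EuclideanSpace ℝ (Fin n))) {φ : EuclideanSpace ℝ (Fin n) → ℝ}
    (h : ContDiff ℝ ∞ φ) (hc : HasCompactSupport φ) (hs : tsupport φ ⊆ Ω) :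
    IsTestFunction Ω Γ φ := by
  refine ⟨h, hc, Set.disjoint_left.2 fun x hx hx' => ?_⟩
  have h1 : x ∈ frontier Ω :=
    (isClosed_frontier.closure_subset_iff.2 Set.sdiff_subset) hx'
  rw [hΩ.frontier_eq] at h1
  exact h1.2 (hs hx)

theorem memLp_of_smooth {n : ℕ} (Ω : Set (EuclideanSpace ℝ (Fin n)))
    {φ : EuclideanSpace ℝ (Fin n) → ℝ} (h : ContDiff ℝ ∞ φ) (hc : HasCompactSupport φ) :
    MemLp φ 2 (volume.restrict Ω) :=
  (h.continuous.memLp_of_hasCompactSupport hc).restrict Ω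

theorem partialDeriv_memLp {n : ℕ} (Ω : Set (EuclideanSpace ℝ (Fin n))) (j : Fin n)
    {φ : EuclideanSpace ℝ (Fin n) → ℝ} (h : ContDiff ℝ ∞ φ) (hc : HasCompactSupport φ) :
    MemLp (partialDeriv j φ) 2 (volume.restrict Ω) :=
  memLp_of_smooth Ω (partialDeriv_contDiff j h)
    (hc.of_isClosed_subset (isClosed_tsupport _) (partialDeriv_tsupport j φ))

/-- Integration against a fixed `L²` function is the inner product with it. -/
theorem integral_mul_eq_inner {n : ℕ} {Ω : Set (EuclideanSpace ℝ (Fin n))}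
    {φ : EuclideanSpace ℝ (Fin n) → ℝ} (h : MemLp φ 2 (volume.restrict Ω))
    (f : Lp ℝ 2 (volume.restrict Ω)) :
    ∫ x in Ω, f x * φ x = inner ℝ h.toLp f := by
  rw [L2.inner_def]
  refine integral_congr_ae ?_
  filter_upwards [h.coeFn_toLp] with x hx
  simp [hx]

theorem isWeakExtDeriv_iff {n k : ℕ} {Ω Γ : Set (EuclideanSpace ℝ (Fin n))}
    (a : L2Form n k Ω) (b : L2Form n (k + 1) Ω) :
    IsWeakExtDeriv Ω Γ a b ↔
      ∀ (J : FormIndex n (k + 1)) (φ : EuclideanSpace ℝ (Fin n) → ℝ) (h : IsTestFunction Ω Γ φ),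
        inner ℝ (memLp_of_smooth Ω h.1 h.2.1).toLp (b J) +
          ∑ j : J.1, J.sign j *
            inner ℝ (partialDeriv_memLp Ω (j : Fin n) h.1 h.2.1).toLp (a (J.erase j)) = 0 := by
  unfold IsWeakExtDeriv
  refine forall_congr' fun J => forall_congr' fun φ => forall_congr' fun h => ?_
  rw [integral_mul_eq_inner (memLp_of_smooth Ω h.1 h.2.1), eq_neg_iff_add_eq_zero]
  simp_rw [fun j : J.1 => integral_mul_eq_inner
    (partialDeriv_memLp Ω (j : Fin n) h.1 h.2.1) (a (J.erase j))]

/-- The graph of the weak exterior derivative on `k`-forms with `tr a = 0` on `Γ`. -/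
def extDerivGraph (n k : ℕ) (Ω Γ : Set (EuclideanSpace ℝ (Fin n))) :
    Submodule ℝ (L2Form n k Ω × L2Form n (k + 1) Ω) where
  carrier := {p | IsWeakExtDeriv Ω Γ p.1 p.2}
  zero_mem' := by
    simp only [Set.mem_ofPred_eq, isWeakExtDeriv_iff]
    intro J φ h
    simp
  add_mem' := by
    intro p q hp hq
    simp only [Set.mem_ofPred_eq, isWeakExtDeriv_iff] at hp hq ⊢
    intro J φ h
    have := congrArg₂ (· + ·) (hp J φ h) (hq J φ h)
    simp only [Prod.fst_add, Prod.snd_add, PiLp.add_apply, inner_add_right, mul_add,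
      Finset.sum_add_distrib] at this ⊢
    linarith
  smul_mem' := by
    intro c p hp
    simp only [Set.mem_ofPred_eq, isWeakExtDeriv_iff] at hp ⊢
    intro J φ h
    have := congrArg (c * ·) (hp J φ h)
    simp only [Prod.smul_fst, Prod.smul_snd, PiLp.smul_apply, inner_smul_right, mul_add,
      Finset.mul_sum, mul_zero] at this ⊢
    rw [← this]
    simp only [mul_left_comm]

theorem extDerivGraph_isClosed (n k : ℕ) (Ω Γ : Set (EuclideanSpace ℝ (Fin n))) :
    IsClosed (extDerivGraph n k Ω Γ : Set (L2Form n k Ω × L2Form n (k + 1) Ω)) := by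
  have : (extDerivGraph n k Ω Γ : Set (L2Form n k Ω × L2Form n (k + 1) Ω)) =
      ⋂ (J : FormIndex n (k + 1)) (φ : EuclideanSpace ℝ (Fin n) → ℝ) (h : IsTestFunction Ω Γ φ),
        {p | inner ℝ (memLp_of_smooth Ω h.1 h.2.1).toLp (p.2 J) +
          ∑ j : J.1, J.sign j *
            inner ℝ (partialDeriv_memLp Ω (j : Fin n) h.1 h.2.1).toLp (p.1 (J.erase j)) = 0} := by
    ext p
    simp only [Set.mem_iInter, Set.mem_ofPred_eq]
    exact isWeakExtDeriv_iff p.1 p.2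
  rw [this]
  refine isClosed_iInter fun J => isClosed_iInter fun φ => isClosed_iInter fun h => ?_
  refine isClosed_eq ?_ continuous_const
  fun_prop

/-- An `L²(Ω)` function orthogonal to all smooth functions with compact support in `Ω` is zero. -/
theorem eq_zero_of_inner_smooth {n : ℕ} {Ω : Set (EuclideanSpace ℝ (Fin n))} (hΩ : IsOpen Ω)
    (f : Lp ℝ 2 (volume.restrict Ω))
    (h : ∀ (φ : EuclideanSpace ℝ (Fin n) → ℝ) (h1 : ContDiff ℝ ∞ φ) (h2 : HasCompactSupport φ),
      tsupport φ ⊆ Ω → inner ℝ (memLp_of_smooth Ω h1 h2).toLp f = 0) : f = 0 := by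
  have hloc : LocallyIntegrable f (volume.restrict Ω) :=
    (Lp.memLp f).locallyIntegrable (by norm_num)
  have hloc' : LocallyIntegrableOn f Ω (volume : Measure (EuclideanSpace ℝ (Fin n))) := by
    rw [locallyIntegrableOn_iff hΩ.isLocallyClosed]
    intro K hKΩ hK
    have := hloc.integrableOn_isCompact hK
    rwa [IntegrableOn, Measure.restrict_restrict hK.measurableSet,
      Set.inter_eq_self_of_subset_left hKΩ] at this
  have key := hΩ.ae_eq_zero_of_integral_contDiff_smul_eq_zero hloc' (fun φ h1 h2 h3 => by
    have e := h φ h1 h2 h3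
    rw [← integral_mul_eq_inner] at e
    rw [← e, ← setIntegral_eq_integral_of_forall_compl_eq_zero (s := Ω)]
    · exact integral_congr_ae (Filter.Eventually.of_forall fun x => by simp [mul_comm])
    · intro x hx
      have : φ x = 0 := image_eq_zero_of_notMem_tsupport fun hx' => hx (h3 hx')
      simp [this])
  rw [Lp.eq_zero_iff_ae_eq_zero]
  exact (ae_restrict_iff' hΩ.measurableSet).2 key

theorem extDerivGraph_functional {n k : ℕ} {Ω : Set (EuclideanSpace ℝ (Fin n))} (hΩ : IsOpen Ω)
    (Γ : Set (EuclideanSpace ℝ (Fin n))) (p : L2Form n k Ω × L2Form n (k + 1) Ω)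
    (hp : p ∈ extDerivGraph n k Ω Γ) (h0 : p.1 = 0) : p.2 = 0 := by
  ext1 J
  refine eq_zero_of_inner_smooth hΩ _ fun φ h1 h2 h3 => ?_
  have := (isWeakExtDeriv_iff p.1 p.2).1 hp J φ (IsTestFunction.of_tsupport hΩ Γ h1 h2 h3)
  simpa [h0] using this

/-- The weak exterior derivative on `{a ∈ HΛᵏ(Ω) | tr a = 0 on Γ}`, as an unbounded operator
`L²Λᵏ(Ω) → L²Λᵏ⁺¹(Ω)`. -/
def weakExtDeriv (n k : ℕ) (Ω Γ : Set (EuclideanSpace ℝ (Fin n))) :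
    L2Form n k Ω →ₗ.[ℝ] L2Form n (k + 1) Ω :=
  (extDerivGraph n k Ω Γ).toLinearPMap

theorem weakExtDeriv_graph {n k : ℕ} {Ω : Set (EuclideanSpace ℝ (Fin n))} (hΩ : IsOpen Ω)
    (Γ : Set (EuclideanSpace ℝ (Fin n))) :
    (weakExtDeriv n k Ω Γ).graph = extDerivGraph n k Ω Γ :=
  Submodule.toLinearPMap_graph_eq _ fun p hp h0 => extDerivGraph_functional hΩ Γ p hp h0

theorem weakExtDeriv_isClosed {n k : ℕ} {Ω : Set (EuclideanSpace ℝ (Fin n))} (hΩ : IsOpen Ω)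
    (Γ : Set (EuclideanSpace ℝ (Fin n))) : (weakExtDeriv n k Ω Γ).IsClosed := by
  unfold LinearPMap.IsClosed
  rw [weakExtDeriv_graph hΩ]
  exact extDerivGraph_isClosed n k Ω Γ

theorem FormIndex.sign_lt {n k : ℕ} (K : FormIndex n (k + 2)) (j : K.1) (i : (K.erase j).1)
    (hi : (i : Fin n) ∈ K.1) (hj : (j : Fin n) ∈ (K.erase ⟨i, hi⟩).1)
    (h : (j : Fin n) < (i : Fin n)) :
    K.sign j * (K.erase j).sign i = - (K.sign ⟨i, hi⟩ * (K.erase ⟨i, hi⟩).sign ⟨j, hj⟩) := by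
  have h1 : ((K.erase ⟨i, hi⟩).1.filter (fun l => l < (j : Fin n))) =
      K.1.filter (fun l => l < (j : Fin n)) := by
    ext l
    simp only [FormIndex.erase, Finset.mem_filter, Finset.mem_erase]
    constructor
    · rintro ⟨⟨-, h2⟩, h3⟩
      exact ⟨h2, h3⟩
    · rintro ⟨h2, h3⟩
      exact ⟨⟨(h3.trans h).ne, h2⟩, h3⟩
  have h2 : (K.1.filter (fun l => l < (i : Fin n))).card =
      ((K.erase j).1.filter (fun l => l < (i : Fin n))).card + 1 := by
    have e : (K.erase j).1.filter (fun l => l < (i : Fin n)) =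
        (K.1.filter (fun l => l < (i : Fin n))).erase (j : Fin n) := by
      simp only [FormIndex.erase, Finset.filter_erase]
    rw [e, Finset.card_erase_add_one]
    exact Finset.mem_filter.2 ⟨j.2, h⟩
  simp only [FormIndex.sign]
  rw [h1, h2]
  ring

theorem FormIndex.sign_swap {n k : ℕ} (K : FormIndex n (k + 2)) (j : K.1) (i : (K.erase j).1)
    (hi : (i : Fin n) ∈ K.1) (hj : (j : Fin n) ∈ (K.erase ⟨i, hi⟩).1) :
    K.sign j * (K.erase j).sign i = - (K.sign ⟨i, hi⟩ * (K.erase ⟨i, hi⟩).sign ⟨j, hj⟩) := by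
  have hne : (i : Fin n) ≠ (j : Fin n) := (Finset.mem_erase.1 i.2).1
  rcases lt_or_gt_of_ne hne with h | h
  · have := FormIndex.sign_lt K ⟨i, hi⟩ ⟨j, hj⟩ j.2 i.2 h
    linarith
  · exact FormIndex.sign_lt K j i hi hj h

theorem partialDeriv_comm {n : ℕ} (i j : Fin n) {φ : EuclideanSpace ℝ (Fin n) → ℝ}
    (h : ContDiff ℝ ∞ φ) :
    partialDeriv i (partialDeriv j φ) = partialDeriv j (partialDeriv i φ) := by
  ext x
  have hd : DifferentiableAt ℝ (fderiv ℝ φ) x :=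
    ((h.fderiv_right (m := ∞) (by norm_num)).differentiable (by simp)) x
  have e : ∀ i j : Fin n, partialDeriv i (partialDeriv j φ) x =
      fderiv ℝ (fderiv ℝ φ) x (EuclideanSpace.single i 1) (EuclideanSpace.single j 1) := by
    intro i j
    unfold partialDeriv
    rw [fderiv_clm_apply hd (differentiableAt_const _)]
    simp
  rw [e, e]
  exact (h.contDiffAt.isSymmSndFDerivAt
    (by rw [minSmoothness_of_isRCLikeNormedField]; exact ENat.LEInfty.out)) _ _

/-- `d ∘ d = 0`; the boundary condition `tr a = 0` on `Γ` is inherited by `d a` on `Γ' ⊆ Γ`. -/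
theorem isWeakExtDeriv_zero {n k : ℕ} {Ω Γ Γ' : Set (EuclideanSpace ℝ (Fin n))} (hΓ : Γ' ⊆ Γ)
    {a : L2Form n k Ω} {b : L2Form n (k + 1) Ω} (h : IsWeakExtDeriv Ω Γ a b) :
    IsWeakExtDeriv Ω Γ' b 0 := by
  rw [isWeakExtDeriv_iff]
  intro K φ hφ
  have e1 : ∀ j : K.1,
      inner ℝ (partialDeriv_memLp Ω (j : Fin n) hφ.1 hφ.2.1).toLp (b (K.erase j)) =
      - ∑ i : (K.erase j).1, (K.erase j).sign i *
        ∫ x in Ω, a ((K.erase j).erase i) x *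
          partialDeriv (i : Fin n) (partialDeriv (j : Fin n) φ) x := by
    intro j
    rw [← integral_mul_eq_inner]
    exact h (K.erase j) _ ((hφ.mono hΓ).partialDeriv j)
  simp only [e1]
  have e2 : ∑ p : (Σ j : K.1, (K.erase j).1), K.sign p.1 * ((K.erase p.1).sign p.2 *
      ∫ x in Ω, a ((K.erase p.1).erase p.2) x *
        partialDeriv (p.2 : Fin n) (partialDeriv (p.1 : Fin n) φ) x) = 0 := by
    have hmem : ∀ p : (Σ j : K.1, (K.erase j).1), (p.2 : Fin n) ∈ K.1 := fun p =>
      (Finset.mem_erase.1 p.2.2).2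
    have hmem' : ∀ p : (Σ j : K.1, (K.erase j).1),
        (p.1 : Fin n) ∈ (K.erase ⟨p.2, hmem p⟩).1 := fun p =>
      Finset.mem_erase.2 ⟨(Finset.mem_erase.1 p.2.2).1.symm, p.1.2⟩
    refine Finset.sum_involution
      (fun p _ => (⟨⟨p.2, hmem p⟩, ⟨p.1, hmem' p⟩⟩ : (Σ j : K.1, (K.erase j).1))) ?_ ?_ ?_ ?_
    · rintro p -
      have hs := FormIndex.sign_swap K p.1 p.2 (hmem p) (hmem' p)
      have hidx : (K.erase ⟨p.2, hmem p⟩).erase ⟨p.1, hmem' p⟩ = (K.erase p.1).erase p.2 := by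
        apply Subtype.ext
        simp only [FormIndex.erase]
        exact Finset.erase_right_comm
      simp only [hidx]
      rw [partialDeriv_comm _ _ hφ.1, ← mul_assoc, ← mul_assoc, hs]
      ring
    · rintro p - - hp
      have h1 : (p.2 : Fin n) = (p.1 : Fin n) := by
        have := congrArg (fun q : (Σ j : K.1, (K.erase j).1) => (q.1 : Fin n)) hp
        exact this
      exact (Finset.mem_erase.1 p.2.2).1 h1
    · intro p _
      exact Finset.mem_univ _
    · intro p _
      rfl
  rw [Fintype.sum_sigma] at e2
  simp only [PiLp.zero_apply, inner_zero_right, zero_add, mul_neg, Finset.sum_neg_distrib,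
    Finset.mul_sum, neg_eq_zero]
  exact e2

theorem weakExtDeriv_comp {n k : ℕ} {Ω Γ Γ' : Set (EuclideanSpace ℝ (Fin n))} (hΩ : IsOpen Ω)
    (hΓ : Γ' ⊆ Γ) (a : (weakExtDeriv n k Ω Γ).domain) :
    ∃ h : weakExtDeriv n k Ω Γ a ∈ (weakExtDeriv n (k + 1) Ω Γ').domain,
      weakExtDeriv n (k + 1) Ω Γ' ⟨weakExtDeriv n k Ω Γ a, h⟩ = 0 := by
  have h1 : ((a : L2Form n k Ω), weakExtDeriv n k Ω Γ a) ∈ extDerivGraph n k Ω Γ := by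
    rw [← weakExtDeriv_graph hΩ]
    exact LinearPMap.mem_graph _ a
  have h2 : (weakExtDeriv n k Ω Γ a, (0 : L2Form n (k + 2) Ω)) ∈
      (weakExtDeriv n (k + 1) Ω Γ').graph := by
    rw [weakExtDeriv_graph hΩ]
    exact isWeakExtDeriv_zero hΓ h1
  obtain ⟨y, hy1, hy2⟩ := (LinearPMap.mem_graph_iff _).1 h2
  simp only at hy1 hy2
  refine ⟨hy1 ▸ y.2, ?_⟩
  rw [← hy2]
  congr 1
  exact Subtype.ext hy1.symm

theorem integral_smooth_by_parts {n : ℕ} {Ω : Set (EuclideanSpace ℝ (Fin n))} (j : Fin n)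
    {φ ψ : EuclideanSpace ℝ (Fin n) → ℝ} (h1 : ContDiff ℝ ∞ φ) (h2 : HasCompactSupport φ)
    (h3 : tsupport φ ⊆ Ω) (k1 : ContDiff ℝ ∞ ψ) :
    ∫ x in Ω, partialDeriv j φ x * ψ x = - ∫ x in Ω, φ x * partialDeriv j ψ x := by
  have hz : ∀ x, x ∉ Ω → φ x = 0 := fun x hx =>
    image_eq_zero_of_notMem_tsupport fun hx' => hx (h3 hx')
  have hz' : ∀ x, x ∉ Ω → partialDeriv j φ x = 0 := fun x hx =>
    image_eq_zero_of_notMem_tsupport fun hx' => hx (h3 (partialDeriv_tsupport j φ hx'))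
  rw [setIntegral_eq_integral_of_forall_compl_eq_zero (fun x hx => by rw [hz' x hx, zero_mul]),
    setIntegral_eq_integral_of_forall_compl_eq_zero (fun x hx => by rw [hz x hx, zero_mul])]
  have c1 := (partialDeriv_contDiff j h1).continuous
  have c2 := (partialDeriv_contDiff j k1).continuous
  have s1 : HasCompactSupport (partialDeriv j φ) :=
    h2.of_isClosed_subset (isClosed_tsupport _) (partialDeriv_tsupport j φ)
  have := integral_mul_fderiv_eq_neg_fderiv_mul_of_integrable
    (μ := (volume : Measure (EuclideanSpace ℝ (Fin n)))) (f := φ) (g := ψ)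
    (v := EuclideanSpace.single j 1)
    ((c1.mul k1.continuous).integrable_of_hasCompactSupport s1.mul_right)
    ((h1.continuous.mul c2).integrable_of_hasCompactSupport h2.mul_right)
    ((h1.continuous.mul k1.continuous).integrable_of_hasCompactSupport h2.mul_right)
    (fun x _ => (h1.differentiable (by simp)) x) (fun x _ => (k1.differentiable (by simp)) x)
  unfold partialDeriv
  rw [this, neg_neg]

open Classical in
theorem weakExtDeriv_dense {n k : ℕ} {Ω : Set (EuclideanSpace ℝ (Fin n))} (hΩ : IsOpen Ω)
    (Γ : Set (EuclideanSpace ℝ (Fin n))) :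
    Dense ((weakExtDeriv n k Ω Γ).domain : Set (L2Form n k Ω)) := by
  rw [Submodule.dense_iff_topologicalClosure_eq_top, Submodule.topologicalClosure_eq_top_iff,
    Submodule.eq_bot_iff]
  intro g hg
  ext1 I
  refine eq_zero_of_inner_smooth hΩ _ fun φ h1 h2 h3 => ?_
  have hdom : PiLp.single 2 I (memLp_of_smooth Ω h1 h2).toLp ∈
      (weakExtDeriv n k Ω Γ).domain := by
    rw [LinearPMap.mem_domain_iff]
    refine ⟨WithLp.toLp 2 fun J => ∑ j : J.1, if J.erase j = I then
      J.sign j • (partialDeriv_memLp Ω (j : Fin n) h1 h2).toLp else 0, ?_⟩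
    rw [weakExtDeriv_graph hΩ]
    refine (isWeakExtDeriv_iff _ _).2 fun J ψ hψ => ?_
    simp only [inner_sum]
    rw [← Finset.sum_add_distrib]
    refine Finset.sum_eq_zero fun j _ => ?_
    by_cases hj : J.erase j = I
    · subst hj
      simp only [if_true, PiLp.single_apply, inner_smul_right]
      rw [← mul_add]
      refine mul_eq_zero_of_right _ ?_
      have := integral_smooth_by_parts (j : Fin n) h1 h2 h3 hψ.1
      rw [← integral_mul_eq_inner, ← integral_mul_eq_inner]
      have e1 : ∫ x in Ω, ((partialDeriv_memLp Ω (j : Fin n) h1 h2).toLp (partialDeriv j φ) :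
            Lp ℝ 2 (volume.restrict Ω)) x * ψ x =
          ∫ x in Ω, partialDeriv j φ x * ψ x := by
        refine integral_congr_ae ?_
        filter_upwards [(partialDeriv_memLp Ω (j : Fin n) h1 h2).coeFn_toLp] with x hx
        rw [hx]
      have e2 : ∫ x in Ω, ((memLp_of_smooth Ω h1 h2).toLp φ : Lp ℝ 2 (volume.restrict Ω)) x *
            partialDeriv j ψ x =
          ∫ x in Ω, φ x * partialDeriv j ψ x := by
        refine integral_congr_ae ?_
        filter_upwards [(memLp_of_smooth Ω h1 h2).coeFn_toLp] with x hx
        rw [hx]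
      rw [e1, e2, this, neg_add_cancel]
    · simp [hj]
  have := (Submodule.mem_orthogonal _ g).1 hg _ hdom
  rw [PiLp.inner_apply, Finset.sum_eq_single I] at this
  · simpa [PiLp.single_apply] using this
  · intro J _ hJ
    simp [hJ]
  · simp

end DeRham

/-! ### Hilbert complexes -/

/-- A Hilbert complex of length `n`: real Hilbert spaces `L²Λᵏ` (zero for `k > n`) and closed
densely defined operators `d : L²Λᵏ → L²Λᵏ⁺¹` with `d ∘ d = 0`. -/
structure HilbertComplex (n : ℕ) where
  L2 : ℕ → Type u
  [instNormed : ∀ k, NormedAddCommGroup (L2 k)]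
  [instInner : ∀ k, InnerProductSpace ℝ (L2 k)]
  [instComplete : ∀ k, CompleteSpace (L2 k)]
  subsingleton_of_lt : ∀ k, n < k → Subsingleton (L2 k)
  op : ∀ k, L2 k →ₗ.[ℝ] L2 (k + 1)
  dense_domain : ∀ k, Dense ((op k).domain : Set (L2 k))
  isClosed_op : ∀ k, (op k).IsClosed
  op_op : ∀ (k : ℕ) (a : (op k).domain),
    ∃ h : op k a ∈ (op (k + 1)).domain, op (k + 1) ⟨op k a, h⟩ = 0

attribute [instance] HilbertComplex.instNormed
attribute [instance] HilbertComplex.instInner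
attribute [instance] HilbertComplex.instComplete

/-- The `L²` de Rham complex of an open set `Ω ⊆ ℝⁿ` in which `k`-forms satisfy the essential
boundary condition `tr a = 0` on `Γ k ⊆ ∂Ω`. -/
def deRhamComplex (n : ℕ) (Ω : Set (EuclideanSpace ℝ (Fin n))) (hΩ : IsOpen Ω)
    (Γ : ℕ → Set (EuclideanSpace ℝ (Fin n))) (hΓ : Antitone Γ) : HilbertComplex.{0} n where
  L2 k := L2Form n k Ω
  subsingleton_of_lt k hk := by
    have : IsEmpty (FormIndex n k) := ⟨fun I => by
      have h := Finset.card_le_univ I.1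
      rw [I.2, Fintype.card_fin] at h
      omega⟩
    exact ⟨fun a b => PiLp.ext fun I => isEmptyElim I⟩
  op k := weakExtDeriv n k Ω (Γ k)
  dense_domain k := weakExtDeriv_dense hΩ (Γ k)
  isClosed_op k := weakExtDeriv_isClosed hΩ (Γ k)
  op_op k a := weakExtDeriv_comp hΩ (hΓ (Nat.le_succ k)) a

namespace HilbertComplex

variable {n : ℕ} (H : HilbertComplex.{u} n)

/-- `HΛᵏ`, the domain of `d` in `L²Λᵏ`. -/
abbrev HΛ (k : ℕ) : Submodule ℝ (H.L2 k) := (H.op k).domain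

/-- The norm of `HΛᵏ`: `‖a‖² = ‖a‖²_{L²} + ‖d a‖²_{L²}`. -/
def hnorm {k : ℕ} (a : H.HΛ k) : ℝ := √(‖(a : H.L2 k)‖ ^ 2 + ‖H.op k a‖ ^ 2)

/-- `d : HΛᵏ → HΛᵏ⁺¹`. -/
def d (k : ℕ) : H.HΛ k →ₗ[ℝ] H.HΛ (k + 1) where
  toFun a := ⟨H.op k a, (H.op_op k a).1⟩
  map_add' a b := Subtype.ext ((H.op k).map_add a b)
  map_smul' c a := Subtype.ext ((H.op k).map_smul c a)

/-- The complex is closed: every range `d HΛᵏ` is closed in `L²Λᵏ⁺¹`. -/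
def IsClosedComplex : Prop :=
  ∀ k, IsClosed (Set.range (H.op k))

/-- Exactness at degree `k + 1`: every closed `(k + 1)`-form is exact, `𝓩ᵏ⁺¹ = 𝓑ᵏ⁺¹`. -/
def ExactAtSucc (k : ℕ) : Prop :=
  ∀ a : H.HΛ (k + 1), H.op (k + 1) a = 0 → ∃ b : H.HΛ k, H.op k b = (a : H.L2 (k + 1))

/-- The kernel `𝓩_Λ = {a ∈ Λ | d a = 0}` of `d` in a subspace `Λ ⊆ HΛᵏ`. -/
def kernelIn {k : ℕ} (Λ : Submodule ℝ (H.HΛ k)) : Set (H.HΛ k) :=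
  {a | a ∈ Λ ∧ H.op k a = 0}

/-- The orthogonal complement of `𝓩_Λ` in `Λ ⊆ HΛᵏ`. (For `z` with `d z = 0`, orthogonality in
`L²Λᵏ` and in `HΛᵏ` are the same.) -/
def kernelPerpIn {k : ℕ} (Λ : Submodule ℝ (H.HΛ k)) : Set (H.HΛ k) :=
  {a | a ∈ Λ ∧ ∀ z ∈ H.kernelIn Λ, inner ℝ (a : H.L2 k) (z : H.L2 k) = 0}

/-- The Poincaré inequality on `Λ ⊆ HΛᵏ` with constant `c`: `‖a‖_{HΛᵏ} ≤ c ‖d a‖_{L²}` for all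
`a ∈ Λ` orthogonal to the kernel of `d` in `Λ`. -/
def HasPoincare {k : ℕ} (Λ : Submodule ℝ (H.HΛ k)) (c : ℝ) : Prop :=
  ∀ a ∈ H.kernelPerpIn Λ, H.hnorm a ≤ c * ‖H.op k a‖

/-! #### Discretization -/

/-- A finite dimensional subcomplex `(Λ_h, d)` of `(HΛ, d)`. -/
structure Subcomplex where
  Λ : ∀ k, Submodule ℝ (H.HΛ k)
  finiteDimensional : ∀ k, FiniteDimensional ℝ (Λ k)
  d_mem : ∀ (k : ℕ) (a : H.HΛ k), a ∈ Λ k → H.d k a ∈ Λ (k + 1)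

end HilbertComplex

/-- A finite cell complex, given by the number of `k`-cells and the boundary operator
`∂ : C_{k+1} → C_k` on `k`-chains as an incidence matrix. -/
structure CellComplex where
  cells : ℕ → ℕ
  boundary : ∀ k, Matrix (Fin (cells k)) (Fin (cells (k + 1))) ℝ
  boundary_boundary : ∀ k, boundary k * boundary (k + 1) = 0

/-- The `k`-cochains, in the basis dual to the `k`-cells. -/
abbrev CellComplex.Cochain (D : CellComplex) (k : ℕ) : Type := Fin (D.cells k) → ℝ

/-- The coboundary operator, the adjoint of the boundary operator. -/
def CellComplex.coboundary (D : CellComplex) (k : ℕ) : D.Cochain k →ₗ[ℝ] D.Cochain (k + 1) :=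
  Matrix.mulVecLin (D.boundary k).transpose

namespace HilbertComplex

variable {n : ℕ} {H : HilbertComplex.{u} n}

/-- Mimetic operators onto the subcomplex `Λ_h`: a reduction `R` of forms to cochains and a
reconstruction `I` of forms in `Λ_h` from cochains, with `R I = id`, `R d = δ R`, `d I = I δ`. -/
structure Subcomplex.MimeticOperators (S : H.Subcomplex) where
  D : CellComplex
  reduction : ∀ k, H.HΛ k →ₗ[ℝ] D.Cochain k
  reconstruction : ∀ k, D.Cochain k →ₗ[ℝ] H.HΛ k
  range_reconstruction : ∀ k, LinearMap.range (reconstruction k) = S.Λ k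
  reduction_reconstruction : ∀ (k : ℕ) (c : D.Cochain k), reduction k (reconstruction k c) = c
  reduction_d : ∀ (k : ℕ) (a : H.HΛ k),
    reduction (k + 1) (H.d k a) = D.coboundary k (reduction k a)
  d_reconstruction : ∀ (k : ℕ) (c : D.Cochain k),
    H.d k (reconstruction k c) = reconstruction (k + 1) (D.coboundary k c)

/-- The projection `π_h = I ∘ R : HΛᵏ → Λ_hᵏ`. -/
def Subcomplex.MimeticOperators.proj {S : H.Subcomplex} (M : S.MimeticOperators) (k : ℕ) :
    H.HΛ k →ₗ[ℝ] H.HΛ k :=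
  M.reconstruction k ∘ₗ M.reduction k

/-- `π_h` is bounded with constant `C`: `‖π_h a‖_{HΛᵏ} ≤ C ‖a‖_{HΛᵏ}`. -/
def Subcomplex.MimeticOperators.BoundedBy {S : H.Subcomplex} (M : S.MimeticOperators)
    (C : ℝ) : Prop :=
  ∀ (k : ℕ) (a : H.HΛ k), H.hnorm (M.proj k a) ≤ C * H.hnorm a

end HilbertComplex

/-! ### The mixed Stokes problem -/

/-- The quantity `inf_{x ∈ A, x ≠ 0} sup_{y ∈ B, y ≠ 0} b(x, y) / (‖x‖ ‖y‖)`, with values in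
`[-∞, ∞]`. -/
def infSup {X Y : Type*} [Zero X] [Zero Y] (b : X → Y → ℝ) (normX : X → ℝ) (normY : Y → ℝ)
    (A : Set X) (B : Set Y) : EReal :=
  ⨅ x ∈ {x ∈ A | x ≠ 0}, ⨆ y ∈ {y ∈ B | y ≠ 0}, ((b x y / (normX x * normY y) : ℝ) : EReal)

namespace HilbertComplex

variable {m : ℕ} (H : HilbertComplex.{u} (m + 2))

/-- `𝓩^{*,n}`, `n = m + 2`: the kernel of the adjoint `d*` in `L²Λⁿ`, i.e. the orthogonal
complement of `d HΛⁿ⁻¹`. -/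
def ZstarTop : Submodule ℝ (H.L2 (m + 2)) := (LinearMap.range (H.op (m + 1)).toFun)ᗮ

/-- The pressure space `Q`: `L²Λⁿ` modulo `𝓩^{*,n}`, i.e. the orthogonal complement of `𝓩^{*,n}`
in `L²Λⁿ`; it is all of `L²Λⁿ` when `𝓩^{*,n} = 0`. -/
def Q : Submodule ℝ (H.L2 (m + 2)) := (H.ZstarTop)ᗮ

/-- `a(τ, κ) = (τ, κ)_Ω` on `W × W`, `W = HΛⁿ⁻²`. -/
def formA (τ κ : H.HΛ m) : ℝ := inner ℝ (τ : H.L2 m) (κ : H.L2 m)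

/-- `b(v, q) = (d v, q)_Ω` on `V × Q`, `V = HΛⁿ⁻¹`. -/
def formB (v : H.HΛ (m + 1)) (q : H.Q) : ℝ := inner ℝ (H.op (m + 1) v) (q : H.L2 (m + 2))

/-- `c(τ, v) = (d τ, v)_Ω` on `W × V`. -/
def formC (τ : H.HΛ m) (v : H.HΛ (m + 1)) : ℝ := inner ℝ (H.op m τ) (v : H.L2 (m + 1))

/-- `e(v, w) = (d v, d w)_Ω` on `V × V`. -/
def formE (v w : H.HΛ (m + 1)) : ℝ := inner ℝ (H.op (m + 1) v) (H.op (m + 1) w)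

/-- The inf-sup and coercivity conditions of the mixed Stokes problem on subspaces
`W₀ ⊆ W`, `V₀ ⊆ V`, `Q₀ ⊆ Q`, with constants `α` (for `a` on `Z_W`), `β` (for `b`), `γ` (for `c`)
and `ε` (for `e` on `Z_V^⊥`). -/
structure StokesInfSup (W₀ : Submodule ℝ (H.HΛ m)) (V₀ : Submodule ℝ (H.HΛ (m + 1)))
    (Q₀ : Submodule ℝ H.Q) (α β γ ε : ℝ) : Prop where
  coercive_a : (α : EReal) ≤
    infSup (fun τ κ => H.formA τ κ) H.hnorm H.hnorm (H.kernelIn W₀) (H.kernelIn W₀)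
  coercive_a' : (α : EReal) ≤
    infSup (fun κ τ => H.formA τ κ) H.hnorm H.hnorm (H.kernelIn W₀) (H.kernelIn W₀)
  infsup_b : (β : EReal) ≤
    infSup (fun q v => H.formB v q) (fun q => ‖q‖) H.hnorm (Q₀ : Set H.Q) (V₀ : Set (H.HΛ (m + 1)))
  infsup_c : (γ : EReal) ≤
    infSup (fun v τ => H.formC τ v) H.hnorm H.hnorm (H.kernelIn V₀) (W₀ : Set (H.HΛ m))
  coercive_e : (ε : EReal) ≤
    infSup (fun v w => H.formE v w) H.hnorm H.hnorm (H.kernelPerpIn V₀) (H.kernelPerpIn V₀)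
  coercive_e' : (ε : EReal) ≤
    infSup (fun w v => H.formE v w) H.hnorm H.hnorm (H.kernelPerpIn V₀) (H.kernelPerpIn V₀)

/-- `(ω, u, p) ∈ W₀ × V₀ × Q₀` solves the mixed Stokes problem on `W₀ × V₀ × Q₀` with data
`f`, `g`, `h`. -/
structure IsStokesSolution (W₀ : Submodule ℝ (H.HΛ m)) (V₀ : Submodule ℝ (H.HΛ (m + 1)))
    (Q₀ : Submodule ℝ H.Q) (f : H.HΛ (m + 1) →ₗ[ℝ] ℝ) (g : H.Q →ₗ[ℝ] ℝ) (h : H.HΛ m →ₗ[ℝ] ℝ)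
    (ω : H.HΛ m) (u : H.HΛ (m + 1)) (p : H.Q) : Prop where
  mem_W : ω ∈ W₀
  mem_V : u ∈ V₀
  mem_Q : p ∈ Q₀
  eq_h : ∀ τ ∈ W₀, H.formA τ ω - H.formC τ u = h τ
  eq_f : ∀ v ∈ V₀, H.formE v u + H.formC ω v + H.formB v p = f v
  eq_g : ∀ q ∈ Q₀, H.formB u q = g q

variable {H}

/-- `W_h = Λ_hⁿ⁻²`. -/
abbrev Subcomplex.Wh (S : H.Subcomplex) : Submodule ℝ (H.HΛ m) := S.Λ m

/-- `V_h = Λ_hⁿ⁻¹`. -/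
abbrev Subcomplex.Vh (S : H.Subcomplex) : Submodule ℝ (H.HΛ (m + 1)) := S.Λ (m + 1)

/-- `Q_h = Λ_hⁿ ∩ Q`. -/
def Subcomplex.Qh (S : H.Subcomplex) : Submodule ℝ H.Q :=
  ((S.Λ (m + 2)).map (H.HΛ (m + 2)).subtype).comap H.Q.subtype

/-- The discrete Poincaré inequality on `W_h` and `V_h` with constant `c`. -/
def Subcomplex.HasDiscretePoincare (S : H.Subcomplex) (c : ℝ) : Prop :=
  H.HasPoincare S.Wh c ∧ H.HasPoincare S.Vh c

/-- The discrete inf-sup and coercivity conditions with constants `α, β, γ, ε`. -/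
def Subcomplex.DiscreteInfSup (S : H.Subcomplex) (α β γ ε : ℝ) : Prop :=
  H.StokesInfSup S.Wh S.Vh S.Qh α β γ ε

/-- The discrete mixed Stokes problem has, for all bounded linear forms `f`, `g`, `h` on
`V`, `Q`, `W`, exactly one solution, and it is bounded by `K` times the norms of the data. -/
def Subcomplex.StablyUniquelySolvable (S : H.Subcomplex) (K : ℝ) : Prop :=
  ∀ (f : H.HΛ (m + 1) →ₗ[ℝ] ℝ) (g : H.Q →ₗ[ℝ] ℝ) (h : H.HΛ m →ₗ[ℝ] ℝ) (nf ng nh : ℝ),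
    0 ≤ nf → 0 ≤ ng → 0 ≤ nh →
    (∀ v, |f v| ≤ nf * H.hnorm v) → (∀ q, |g q| ≤ ng * ‖q‖) → (∀ τ, |h τ| ≤ nh * H.hnorm τ) →
    ∃ (ω : H.HΛ m) (u : H.HΛ (m + 1)) (p : H.Q),
      H.IsStokesSolution S.Wh S.Vh S.Qh f g h ω u p ∧
      (∀ (ω' : H.HΛ m) (u' : H.HΛ (m + 1)) (p' : H.Q),
        H.IsStokesSolution S.Wh S.Vh S.Qh f g h ω' u' p' → ω' = ω ∧ u' = u ∧ p' = p) ∧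
      H.hnorm ω + H.hnorm u + ‖p‖ ≤ K * (nf + ng + nh)

variable (H)

/-- The Poincaré inequality of `(HΛ, d)` on `W` and `V` with constant `c`. -/
def HasPoincareConst (c : ℝ) : Prop :=
  H.HasPoincare (⊤ : Submodule ℝ (H.HΛ m)) c ∧ H.HasPoincare (⊤ : Submodule ℝ (H.HΛ (m + 1))) c

/-- The inf-sup and coercivity conditions of the continuous problem on `W × V × Q`. -/
def ContinuousInfSup (α β γ ε : ℝ) : Prop := H.StokesInfSup ⊤ ⊤ ⊤ α β γ ε

/-- Well-posedness of the mixed Stokes problem on all compatible discretizations of the complex.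
The constants `αh, βh, γh, εh, Kh` are functions of the discrete Poincaré constant, the constants
`α, β, γ, ε` are functions of the Poincaré constant of `(HΛ, d)`. -/
structure StokesWellPosed (αh βh γh εh Kh α β γ ε : ℝ → ℝ) : Prop where
  exists_poincare : ∃ c, 0 < c ∧ H.HasPoincareConst c
  continuous_infSup : ∀ c, 0 < c → H.HasPoincareConst c →
    H.ContinuousInfSup (α c) (β c) (γ c) (ε c)
  discrete_poincare : ∀ (S : H.Subcomplex) (M : S.MimeticOperators) (c C : ℝ), 0 < c → 0 < C →
    H.HasPoincareConst c → M.BoundedBy C → S.HasDiscretePoincare (C * c)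
  discrete_infSup : ∀ (S : H.Subcomplex), Nonempty S.MimeticOperators → ∀ c, 0 < c →
    S.HasDiscretePoincare c → S.DiscreteInfSup (αh c) (βh c) (γh c) (εh c)
  discrete_solvable : ∀ (S : H.Subcomplex), Nonempty S.MimeticOperators → ∀ c, 0 < c →
    S.HasDiscretePoincare c → S.StablyUniquelySolvable (Kh c)

end HilbertComplex

end

/-! Continuous and discrete problems are treated by one argument, which uses only two facts about a
triple $(W_0,V_0,Q_0)$: the Poincaré inequality in the two lower degrees, and exactness of $W_0\to
V_0\to Q_0\to 0$. These are bundled in `IsStokesTriple`. Together they give every closed $v\in V_0$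
and every $q\in Q_0$ a potential whose norm is at most $c$ times that of the datum.

Inserting these potentials in the suprema gives $\beta=\gamma=c^{-1}$; on kernels the graph norm is
the $L^2$ norm, so $\alpha=1$; the Poincaré inequality itself gives $\varepsilon=c^{-2}$
(`stokesInfSup`). Used as test functions in the mixed system, they also give the a priori bound
`estimate`. Its case of zero data is uniqueness, which in finite dimensions implies existence.

For the whole complex, closed ranges yield the Poincaré inequality by the open mapping theorem, and
make $d:V\to Q$ surjective. For a subcomplex, exactness is inherited through $\pi_h$: it commutes
with $d$ and fixes $\Lambda_h$, so it maps a potential of a discrete form to a discrete potential.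
If $\pi_h$ is bounded, the Poincaré inequality is inherited in the same way. -/

namespace HilbertComplex

variable {n : ℕ} (H : HilbertComplex.{u} n)

/-! ### The graph norm. -/

theorem hnorm_eq_norm_graph {k : ℕ} (a : H.HΛ k) :
    H.hnorm a = ‖WithLp.toLp 2 ((a : H.L2 k), H.op k a)‖ := by
  rw [WithLp.prod_norm_eq_of_L2]
  rfl

theorem hnorm_nonneg {k : ℕ} (a : H.HΛ k) : 0 ≤ H.hnorm a := Real.sqrt_nonneg _

theorem hnorm_add_le {k : ℕ} (a b : H.HΛ k) : H.hnorm (a + b) ≤ H.hnorm a + H.hnorm b := by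
  simp only [hnorm_eq_norm_graph, LinearPMap.map_add, Submodule.coe_add]
  exact norm_add_le (WithLp.toLp 2 ((a : H.L2 k), H.op k a))
    (WithLp.toLp 2 ((b : H.L2 k), H.op k b))

theorem norm_le_hnorm {k : ℕ} (a : H.HΛ k) : ‖(a : H.L2 k)‖ ≤ H.hnorm a :=
  Real.le_sqrt_of_sq_le (by nlinarith [sq_nonneg ‖H.op k a‖])

theorem norm_op_le_hnorm {k : ℕ} (a : H.HΛ k) : ‖H.op k a‖ ≤ H.hnorm a :=
  Real.le_sqrt_of_sq_le (by nlinarith [sq_nonneg ‖(a : H.L2 k)‖])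

theorem hnorm_eq_norm_of_op_eq_zero {k : ℕ} {a : H.HΛ k} (h : H.op k a = 0) :
    H.hnorm a = ‖(a : H.L2 k)‖ := by
  simp [hnorm, h, Real.sqrt_sq]

theorem eq_zero_of_hnorm_nonpos {k : ℕ} {a : H.HΛ k} (h : H.hnorm a ≤ 0) : a = 0 := by
  have := (H.norm_le_hnorm a).trans h
  exact Subtype.ext (norm_le_zero_iff.1 this)

theorem hnorm_pos {k : ℕ} {a : H.HΛ k} (h : a ≠ 0) : 0 < H.hnorm a :=
  not_le.1 fun h' => h (H.eq_zero_of_hnorm_nonpos h')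

theorem op_d {k : ℕ} (a : H.HΛ k) : H.op (k + 1) (H.d k a) = 0 := (H.op_op k a).2

theorem hnorm_d {k : ℕ} (a : H.HΛ k) : H.hnorm (H.d k a) = ‖H.op k a‖ :=
  H.hnorm_eq_norm_of_op_eq_zero (H.op_d a)

/-! ### Orthogonal splitting by the kernel, and Poincaré inequalities. -/

/-- `𝓩_Λ` as a subspace of `L²Λᵏ`. -/
noncomputable def kernelL2 {k : ℕ} (Λ : Submodule ℝ (H.HΛ k)) : Submodule ℝ (H.L2 k) :=
  (Λ ⊓ LinearMap.ker (H.op k).toFun).map (H.HΛ k).subtype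

theorem mem_kernelL2 {k : ℕ} {Λ : Submodule ℝ (H.HΛ k)} {x : H.L2 k} :
    x ∈ H.kernelL2 Λ ↔ ∃ z ∈ H.kernelIn Λ, (z : H.L2 k) = x := by
  rfl

/-- The splitting `Λ = 𝓩_Λ ⊕ 𝓩_Λ^⊥`. -/
theorem exists_kernel_add_kernelPerp {k : ℕ} {Λ : Submodule ℝ (H.HΛ k)}
    [(H.kernelL2 Λ).HasOrthogonalProjection] {a : H.HΛ k} (ha : a ∈ Λ) :
    ∃ z ∈ H.kernelIn Λ, ∃ y ∈ H.kernelPerpIn Λ, a = z + y ∧ H.op k y = H.op k a := by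
  -- The projection is taken in the ambient $L^2$ space. The kernel part lies in $\Lambda$, hence so
  -- does the remainder.
  obtain ⟨x, hx, w, hw, h⟩ := (H.kernelL2 Λ).exists_add_mem_mem_orthogonal (a : H.L2 k)
  obtain ⟨z, hz, rfl⟩ := H.mem_kernelL2.1 hx
  have hwz : ((a - z : H.HΛ k) : H.L2 k) = w := by
    rw [Submodule.coe_sub, h, add_sub_cancel_left]
  refine ⟨z, hz, a - z, ⟨Λ.sub_mem ha hz.1, fun z' hz' => ?_⟩, by abel, ?_⟩
  · rw [hwz]
    exact (Submodule.mem_orthogonal' _ _).1 hw _ (H.mem_kernelL2.2 ⟨z', hz', rfl⟩)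
  · rw [LinearPMap.map_sub, hz.2, sub_zero]

/-- The element of `𝓩_Λ^⊥` has the least norm among the potentials in `Λ` of a given form. -/
theorem hnorm_le_of_mem_kernelPerpIn {k : ℕ} {Λ : Submodule ℝ (H.HΛ k)} {a x : H.HΛ k}
    (ha : a ∈ H.kernelPerpIn Λ) (hx : x ∈ Λ) (h : H.op k x = H.op k a) :
    H.hnorm a ≤ H.hnorm x := by
  -- Two potentials of the same form differ by a kernel element, to which $a$ is orthogonal;
  -- Pythagoras does the rest.
  have h0 := ha.2 (x - a) ⟨Λ.sub_mem hx ha.1, by rw [LinearPMap.map_sub, h, sub_self]⟩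
  have h1 : ‖(x : H.L2 k)‖ ^ 2 = ‖(a : H.L2 k)‖ ^ 2 + ‖((x - a : H.HΛ k) : H.L2 k)‖ ^ 2 := by
    have := norm_add_sq_real (a : H.L2 k) ((x - a : H.HΛ k) : H.L2 k)
    rw [h0, ← Submodule.coe_add, add_sub_cancel] at this
    linarith
  refine Real.sqrt_le_sqrt ?_
  rw [h1, h]
  nlinarith [sq_nonneg ‖((x - a : H.HΛ k) : H.L2 k)‖]

theorem HasPoincare.exists_potential {H : HilbertComplex.{u} n} {k : ℕ}
    {Λ : Submodule ℝ (H.HΛ k)} {c : ℝ} (hP : H.HasPoincare Λ c)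
    [(H.kernelL2 Λ).HasOrthogonalProjection] {a : H.HΛ k} (ha : a ∈ Λ) :
    ∃ y ∈ H.kernelPerpIn Λ, H.op k y = H.op k a ∧ H.hnorm y ≤ c * ‖H.op k a‖ := by
  obtain ⟨z, -, y, hy, -, h⟩ := H.exists_kernel_add_kernelPerp ha
  exact ⟨y, hy, h, h ▸ hP y hy⟩

/-- The operator is unbounded, but its graph is closed, and the kernel is the slice of the graph at
second component $0$. -/
theorem isClosed_kernelL2_top (k : ℕ) :
    IsClosed (H.kernelL2 (⊤ : Submodule ℝ (H.HΛ k)) : Set (H.L2 k)) := by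
  have : (H.kernelL2 (⊤ : Submodule ℝ (H.HΛ k)) : Set (H.L2 k)) =
      (fun x => (x, (0 : H.L2 (k + 1)))) ⁻¹' ((H.op k).graph : Set (H.L2 k × H.L2 (k + 1))) := by
    ext x
    simp only [SetLike.mem_coe, Set.mem_preimage, mem_kernelL2, LinearPMap.mem_graph_iff]
    constructor
    · rintro ⟨z, hz, rfl⟩
      exact ⟨z, rfl, hz.2⟩
    · rintro ⟨z, rfl, hz⟩
      exact ⟨z, ⟨Submodule.mem_top, hz⟩, rfl⟩
  rw [this]
  exact (H.isClosed_op k).preimage (by fun_prop)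

instance hasOrthogonalProjection_kernelL2_top (k : ℕ) :
    (H.kernelL2 (⊤ : Submodule ℝ (H.HΛ k))).HasOrthogonalProjection := by
  have := (H.isClosed_kernelL2_top k).completeSpace_coe
  infer_instance

instance hasOrthogonalProjection_kernelL2 (S : H.Subcomplex) (k : ℕ) :
    (H.kernelL2 (S.Λ k)).HasOrthogonalProjection := by
  have := S.finiteDimensional k
  have : FiniteDimensional ℝ (S.Λ k ⊓ LinearMap.ker (H.op k).toFun : Submodule ℝ (H.HΛ k)) :=
    Submodule.finiteDimensional_inf_left _ _
  have : FiniteDimensional ℝ (H.kernelL2 (S.Λ k)) := by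
    unfold kernelL2
    infer_instance
  infer_instance

/-- A closed complex satisfies the Poincaré inequality in every degree. -/
theorem IsClosedComplex.exists_hasPoincare {H : HilbertComplex.{u} n} (hH : H.IsClosedComplex)
    (k : ℕ) : ∃ c, ∀ c', c ≤ c' → H.HasPoincare (⊤ : Submodule ℝ (H.HΛ k)) c' := by
  let G : Submodule ℝ (H.L2 k × H.L2 (k + 1)) := (H.op k).graph
  let R : Submodule ℝ (H.L2 (k + 1)) := LinearMap.range (H.op k).toFun
  have : CompleteSpace G := (H.isClosed_op k).completeSpace_coe
  have : CompleteSpace R := IsClosed.completeSpace_coe (hs := hH k)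
  -- On its graph $d$ becomes a bounded surjection between Banach spaces, to which the open mapping
  -- theorem applies.
  let T : G →L[ℝ] R := ((ContinuousLinearMap.snd ℝ (H.L2 k) (H.L2 (k + 1))).comp
    G.subtypeL).codRestrict R fun x => by
      obtain ⟨y, -, hy⟩ := (LinearPMap.mem_graph_iff _).1 x.2
      exact ⟨y, hy⟩
  have hT : Function.Surjective T := by
    rintro ⟨_, a, rfl⟩
    exact ⟨⟨(a, H.op k a), (H.op k).mem_graph a⟩, rfl⟩
  obtain ⟨C, hC, h⟩ := T.exists_preimage_norm_le hT
  -- The graph carries the maximum norm, so $C$ bounds each component separately; `hnorm` is at most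
  -- their sum.
  refine ⟨C + C, fun c' hc' a ha => ?_⟩
  obtain ⟨x, hx, hxC⟩ := h ⟨H.op k a, ⟨a, rfl⟩⟩
  obtain ⟨y, hy1, hy2⟩ := (LinearPMap.mem_graph_iff _).1 x.2
  have hxa : (x : H.L2 k × H.L2 (k + 1)).2 = H.op k a := congrArg Subtype.val hx
  have hx1 : ‖(y : H.L2 k)‖ ≤ C * ‖H.op k a‖ := hy1 ▸ (norm_fst_le _).trans hxC
  have hx2 : ‖H.op k y‖ ≤ C * ‖H.op k a‖ := hy2 ▸ (norm_snd_le _).trans hxC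
  have hle : H.hnorm y ≤ ‖(y : H.L2 k)‖ + ‖H.op k y‖ :=
    Real.sqrt_le_iff.2 ⟨by positivity, by
      nlinarith [mul_nonneg (norm_nonneg (y : H.L2 k)) (norm_nonneg (H.op k y))]⟩
  have := H.hnorm_le_of_mem_kernelPerpIn ha Submodule.mem_top (hy2.trans hxa)
  nlinarith [mul_le_mul_of_nonneg_right hc' (norm_nonneg (H.op k a))]

/-! ### The commuting projection $\pi_h$. -/

section Mimetic

variable {H} {S : H.Subcomplex}

theorem Subcomplex.MimeticOperators.proj_mem (M : S.MimeticOperators) {k : ℕ} (a : H.HΛ k) :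
    M.proj k a ∈ S.Λ k := by
  rw [← M.range_reconstruction k]
  exact ⟨_, rfl⟩

theorem Subcomplex.MimeticOperators.proj_eq_self (M : S.MimeticOperators) {k : ℕ} {a : H.HΛ k}
    (ha : a ∈ S.Λ k) : M.proj k a = a := by
  rw [← M.range_reconstruction k] at ha
  obtain ⟨c, rfl⟩ := ha
  simp [Subcomplex.MimeticOperators.proj, M.reduction_reconstruction]

theorem Subcomplex.MimeticOperators.d_proj (M : S.MimeticOperators) {k : ℕ} (a : H.HΛ k) :
    H.d k (M.proj k a) = M.proj (k + 1) (H.d k a) := by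
  simp [Subcomplex.MimeticOperators.proj, M.d_reconstruction, M.reduction_d]

/-- The projection `π_h` preserves exterior derivatives which lie in the subcomplex. -/
theorem Subcomplex.MimeticOperators.op_proj_eq (M : S.MimeticOperators) {k : ℕ} {a : H.HΛ k}
    (ha : H.d k a ∈ S.Λ (k + 1)) : H.op k (M.proj k a) = H.op k a :=
  congrArg Subtype.val ((M.d_proj a).trans (M.proj_eq_self ha))

/-- For a controlled potential $a$ of $dx$ in the whole complex, $\pi_h a$ is a discrete potential
of $dx$, and $x$, being orthogonal to the discrete kernel, has the least norm among those. -/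
theorem Subcomplex.MimeticOperators.hasPoincare (M : S.MimeticOperators) {k : ℕ} {c C : ℝ}
    (hC : 0 < C) (hP : H.HasPoincare (⊤ : Submodule ℝ (H.HΛ k)) c) (hM : M.BoundedBy C) :
    H.HasPoincare (S.Λ k) (C * c) := by
  intro x hx
  obtain ⟨a, -, hax, hac⟩ := hP.exists_potential (a := x) Submodule.mem_top
  have hd : H.d k a = H.d k x := Subtype.ext hax
  have h := M.op_proj_eq (hd ▸ S.d_mem k x hx.1)
  calc H.hnorm x ≤ H.hnorm (M.proj k a) :=
        H.hnorm_le_of_mem_kernelPerpIn hx (M.proj_mem a) (h.trans hax)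
    _ ≤ C * H.hnorm a := hM k a
    _ ≤ C * (c * ‖H.op k x‖) := by gcongr
    _ = C * c * ‖H.op k x‖ := by ring

end Mimetic

end HilbertComplex

/-! ### Auxiliary facts on inf-sup constants, reals and bilinear forms. -/

theorem le_infSup {X Y : Type*} [Zero X] [Zero Y] {b : X → Y → ℝ} {normX : X → ℝ}
    {normY : Y → ℝ} {A : Set X} {B : Set Y} {r : ℝ}
    (h : ∀ x ∈ A, x ≠ 0 → ∃ y ∈ B, y ≠ 0 ∧ r ≤ b x y / (normX x * normY y)) :
    (r : EReal) ≤ infSup b normX normY A B := by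
  refine le_iInf₂ fun x hx => ?_
  obtain ⟨y, hy, hy0, hr⟩ := h x hx.1 hx.2
  exact (EReal.coe_le_coe_iff.2 hr).trans
    (le_iSup₂ (f := fun y (_ : y ∈ {y ∈ B | y ≠ 0}) =>
      ((b x y / (normX x * normY y) : ℝ) : EReal)) y ⟨hy, hy0⟩)

/-- Applied with $x$ the norm of a datum and $y$ that of its potential; their pairing is then $x^2$.
-/
theorem inv_le_sq_div_mul_of_le_mul {c x y : ℝ} (hc : 0 < c) (hy : 0 < y) (hx : 0 < x)
    (h : y ≤ c * x) :
    c⁻¹ ≤ x ^ 2 / (x * y) := by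
  rw [inv_eq_one_div, div_le_div_iff₀ hc (by positivity)]
  nlinarith [mul_le_mul_of_nonneg_left h hx.le]

/-- Ends each energy argument in `estimate`, where testing bounds a squared norm by a multiple of
the norm. -/
theorem le_of_sq_le_mul_self {x y : ℝ} (hx : 0 ≤ x) (hy : 0 ≤ y)
    (h : x ^ 2 ≤ y * x) : x ≤ y := by
  rcases hx.eq_or_lt with rfl | hx
  · exact hy
  · exact le_of_mul_le_mul_right (by linarith [sq x]) hx

/-- A bilinear form on a finite dimensional space without kernel represents every linear form. -/
theorem LinearMap.surjective_of_ker_eq_bot_dual {E : Type*} [AddCommGroup E] [Module ℝ E]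
    [FiniteDimensional ℝ E] (B : E →ₗ[ℝ] E →ₗ[ℝ] ℝ) (hB : LinearMap.ker B = ⊥) :
    Function.Surjective B :=
  (LinearMap.injective_iff_surjective_of_finrank_eq_finrank
    (Subspace.dual_finrank_eq (K := ℝ) (V := E)).symm).1 (LinearMap.ker_eq_bot.1 hB)

/-! ### Exact triples: inf-sup conditions and the a priori estimate. -/

namespace HilbertComplex

variable {m : ℕ} {H : HilbertComplex.{u} (m + 2)}

/-- The spaces `W₀`, `V₀`, `Q₀` satisfy the Poincaré inequalities with constant `c`, and the
sequence `W₀ → V₀ → Q₀ → 0` is exact. -/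
structure IsStokesTriple (H : HilbertComplex.{u} (m + 2)) (W₀ : Submodule ℝ (H.HΛ m))
    (V₀ : Submodule ℝ (H.HΛ (m + 1))) (Q₀ : Submodule ℝ H.Q) (c : ℝ) : Prop where
  pos : 0 < c
  proj_W : (H.kernelL2 W₀).HasOrthogonalProjection
  proj_V : (H.kernelL2 V₀).HasOrthogonalProjection
  poincare_W : H.HasPoincare W₀ c
  poincare_V : H.HasPoincare V₀ c
  d_mem : ∀ τ ∈ W₀, H.d m τ ∈ V₀
  exact_V : ∀ v ∈ H.kernelIn V₀, ∃ τ ∈ W₀, H.op m τ = (v : H.L2 (m + 1))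
  op_mem : ∀ v ∈ V₀, ∃ q ∈ Q₀, (q : H.L2 (m + 2)) = H.op (m + 1) v
  exact_Q : ∀ q ∈ Q₀, ∃ v ∈ V₀, H.op (m + 1) v = (q : H.L2 (m + 2))

namespace IsStokesTriple

variable {W₀ : Submodule ℝ (H.HΛ m)} {V₀ : Submodule ℝ (H.HΛ (m + 1))} {Q₀ : Submodule ℝ H.Q}
  {c : ℝ}

theorem exists_potential_V (h : H.IsStokesTriple W₀ V₀ Q₀ c) {v : H.HΛ (m + 1)}
    (hv : v ∈ H.kernelIn V₀) :
    ∃ τ ∈ H.kernelPerpIn W₀, H.op m τ = (v : H.L2 (m + 1)) ∧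
      H.hnorm τ ≤ c * ‖(v : H.L2 (m + 1))‖ := by
  have := h.proj_W
  obtain ⟨τ, hτ, e⟩ := h.exact_V v hv
  simpa only [e] using h.poincare_W.exists_potential hτ

theorem exists_potential_Q (h : H.IsStokesTriple W₀ V₀ Q₀ c) {q : H.Q} (hq : q ∈ Q₀) :
    ∃ v ∈ H.kernelPerpIn V₀, H.op (m + 1) v = (q : H.L2 (m + 2)) ∧ H.hnorm v ≤ c * ‖q‖ := by
  have := h.proj_V
  obtain ⟨v, hv, e⟩ := h.exact_Q q hq
  simpa only [e, Submodule.coe_norm] using h.poincare_V.exists_potential hv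

theorem stokesInfSup (h : H.IsStokesTriple W₀ V₀ Q₀ c) :
    H.StokesInfSup W₀ V₀ Q₀ 1 c⁻¹ c⁻¹ (c ^ 2)⁻¹ := by
  have ha : ∀ τ ∈ H.kernelIn W₀, τ ≠ 0 → ∃ κ ∈ H.kernelIn W₀, κ ≠ 0 ∧
      1 ≤ H.formA τ κ / (H.hnorm τ * H.hnorm κ) := by
    intro τ hτ h0
    have hpos := H.hnorm_pos h0
    refine ⟨τ, hτ, h0, ?_⟩
    rw [formA, real_inner_self_eq_norm_sq, ← H.hnorm_eq_norm_of_op_eq_zero hτ.2, ← sq,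
      div_self (by positivity)]
  have he : ∀ v ∈ H.kernelPerpIn V₀, v ≠ 0 → ∃ w ∈ H.kernelPerpIn V₀, w ≠ 0 ∧
      (c ^ 2)⁻¹ ≤ H.formE v w / (H.hnorm v * H.hnorm w) := by
    intro v hv h0
    have hpos := H.hnorm_pos h0
    have hP := h.poincare_V v hv
    have hc := h.pos
    refine ⟨v, hv, h0, ?_⟩
    rw [formE, real_inner_self_eq_norm_sq, inv_eq_one_div,
      div_le_div_iff₀ (by positivity) (by positivity), one_mul, ← sq, mul_comm, ← mul_pow]
    exact pow_le_pow_left₀ hpos.le hP 2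
  refine ⟨le_infSup ha, le_infSup fun κ hκ h0 => ?_, le_infSup fun q hq h0 => ?_,
    le_infSup fun v hv h0 => ?_, le_infSup he, le_infSup fun w hw h0 => ?_⟩
  · obtain ⟨τ, hτ, hτ0, hle⟩ := ha κ hκ h0
    rw [formA, real_inner_comm] at hle
    exact ⟨τ, hτ, hτ0, hle⟩
  · obtain ⟨v, hv, e, hle⟩ := h.exists_potential_Q hq
    have hv0 : v ≠ 0 := by
      rintro rfl
      exact h0 (Subtype.ext (by simpa using e.symm))
    refine ⟨v, hv.1, hv0, ?_⟩
    rw [formB, e, real_inner_self_eq_norm_sq]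
    exact inv_le_sq_div_mul_of_le_mul h.pos (H.hnorm_pos hv0) (norm_pos_iff (a := q).2 h0) hle
  · obtain ⟨τ, hτ, e, hle⟩ := h.exists_potential_V hv
    have hτ0 : τ ≠ 0 := by
      rintro rfl
      exact h0 (Subtype.ext (by simpa using e.symm))
    refine ⟨τ, hτ.1, hτ0, ?_⟩
    have hn := H.hnorm_eq_norm_of_op_eq_zero hv.2
    rw [formC, e, real_inner_self_eq_norm_sq, ← hn]
    exact inv_le_sq_div_mul_of_le_mul h.pos (H.hnorm_pos hτ0) (H.hnorm_pos h0) (hn ▸ hle)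
  · obtain ⟨v, hv, hv0, hle⟩ := he w hw h0
    rw [formE, real_inner_comm] at hle
    exact ⟨v, hv, hv0, hle⟩

/-- The a priori estimate for the mixed Stokes problem. -/
theorem estimate (H₀ : H.IsStokesTriple W₀ V₀ Q₀ c) {f : H.HΛ (m + 1) →ₗ[ℝ] ℝ}
    {g : H.Q →ₗ[ℝ] ℝ} {h : H.HΛ m →ₗ[ℝ] ℝ} {nf ng nh : ℝ} (hnf : 0 ≤ nf) (hng : 0 ≤ ng)
    (hnh : 0 ≤ nh) (hf : ∀ v ∈ V₀, |f v| ≤ nf * H.hnorm v) (hg : ∀ q ∈ Q₀, |g q| ≤ ng * ‖q‖)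
    (hh : ∀ τ ∈ W₀, |h τ| ≤ nh * H.hnorm τ) {ω : H.HΛ m} {u : H.HΛ (m + 1)} {p : H.Q}
    (hs : H.IsStokesSolution W₀ V₀ Q₀ f g h ω u p) :
    H.hnorm ω + H.hnorm u + ‖p‖ ≤ (c ^ 2 + 5 * c + 1) * (nf + ng + nh) := by
  have hc := H₀.pos
  have := H₀.proj_W
  have := H₀.proj_V
  -- Test the third equation with $q=du$.
  have hdu : ‖H.op (m + 1) u‖ ≤ ng := by
    obtain ⟨q, hq, e⟩ := H₀.op_mem u hs.mem_V
    have h1 := hs.eq_g q hq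
    rw [formB, e, real_inner_self_eq_norm_sq] at h1
    have h2 := (le_abs_self _).trans (hg q hq)
    rw [Submodule.coe_norm, e] at h2
    exact le_of_sq_le_mul_self (norm_nonneg _) hng (h1 ▸ h2)
  -- Test the second equation with $v=d\omega$; since $d\,d\omega=0$, the terms with $e$ and $b$
  -- vanish.
  have hdω : ‖H.op m ω‖ ≤ nf := by
    have hm := H₀.d_mem ω hs.mem_W
    have h1 := hs.eq_f _ hm
    have h2 := (le_abs_self _).trans (hf _ hm)
    simp only [formE, formB, formC, H.op_d, inner_zero_left, zero_add, add_zero] at h1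
    rw [show ((H.d m ω : H.HΛ (m + 1)) : H.L2 (m + 1)) = H.op m ω from rfl,
      real_inner_self_eq_norm_sq] at h1
    rw [← h1, H.hnorm_d] at h2
    exact le_of_sq_le_mul_self (norm_nonneg _) hnf h2
  -- The kernel part of $\omega$ is bounded by testing the first equation with it, where $c$
  -- vanishes; the orthogonal part by the Poincaré inequality.
  have hω : H.hnorm ω ≤ c * nf + nh := by
    obtain ⟨z, hz, y, hy, e, ey⟩ := H.exists_kernel_add_kernelPerp hs.mem_W
    have h1 := hs.eq_h z hz.1
    have h2 := (le_abs_self _).trans (hh z hz.1)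
    have h3 : H.hnorm z ≤ nh := by
      refine le_of_sq_le_mul_self (H.hnorm_nonneg _) hnh ?_
      rw [formA, formC, hz.2, inner_zero_left, sub_zero, e, Submodule.coe_add, inner_add_right,
        real_inner_self_eq_norm_sq, real_inner_comm, hy.2 z hz, add_zero,
        ← H.hnorm_eq_norm_of_op_eq_zero hz.2] at h1
      exact h1 ▸ h2
    have h4 : H.hnorm y ≤ c * nf := by
      refine (H₀.poincare_W y hy).trans ?_
      rw [ey]
      gcongr
    rw [e]
    linarith [H.hnorm_add_le z y]
  have hu : H.hnorm u ≤ c * (c * nf + 2 * nh) + c * ng := by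
    obtain ⟨z, hz, y, hy, e, ey⟩ := H.exists_kernel_add_kernelPerp hs.mem_V
    have h3 : H.hnorm z ≤ c * (c * nf + 2 * nh) := by
      refine le_of_sq_le_mul_self (H.hnorm_nonneg _) (by positivity) ?_
      -- With $d\sigma=z$, the kernel part of $u$, the first equation reads
      -- $\|z\|^2=a(\sigma,\omega)-h(\sigma)$.
      obtain ⟨σ, hσ, eσ, hle⟩ := H₀.exists_potential_V hz
      have h1 := hs.eq_h σ hσ.1
      have h2 := (neg_le_abs _).trans (hh σ hσ.1)
      rw [formC, eσ, e, Submodule.coe_add, inner_add_right, real_inner_self_eq_norm_sq,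
        real_inner_comm, hy.2 z hz, add_zero, ← H.hnorm_eq_norm_of_op_eq_zero hz.2] at h1
      rw [← H.hnorm_eq_norm_of_op_eq_zero hz.2] at hle
      have h5 : H.formA σ ω ≤ H.hnorm σ * (c * nf + nh) :=
        (real_inner_le_norm _ _).trans (mul_le_mul (H.norm_le_hnorm _)
          ((H.norm_le_hnorm _).trans hω) (norm_nonneg _) (H.hnorm_nonneg _))
      calc H.hnorm z ^ 2 ≤ H.hnorm σ * (c * nf + 2 * nh) := by linarith
        _ ≤ c * H.hnorm z * (c * nf + 2 * nh) := by gcongr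
        _ = _ := by ring
    have h4 : H.hnorm y ≤ c * ng := by
      refine (H₀.poincare_V y hy).trans ?_
      rw [ey]
      gcongr
    rw [e]
    linarith [H.hnorm_add_le z y]
  have hp : ‖p‖ ≤ c * (2 * nf + ng) := by
    refine le_of_sq_le_mul_self (norm_nonneg _) (by positivity) ?_
    -- With $dv=p$, the second equation reads $\|p\|^2=f(v)-e(v,u)-c(\omega,v)$, and $du$ and
    -- $d\omega$ are already bounded.
    obtain ⟨v, hv, ev, hle⟩ := H₀.exists_potential_Q hs.mem_Q
    have h1 := hs.eq_f v hv.1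
    have h2 := (le_abs_self _).trans (hf v hv.1)
    rw [formB, ev, real_inner_self_eq_norm_sq] at h1
    have h5 : -H.formE v u ≤ H.hnorm v * ng :=
      (neg_le_abs _).trans ((abs_real_inner_le_norm _ _).trans (mul_le_mul (H.norm_op_le_hnorm _)
          hdu (norm_nonneg _) (H.hnorm_nonneg _)))
    have h6 : -H.formC ω v ≤ nf * H.hnorm v :=
      (neg_le_abs _).trans ((abs_real_inner_le_norm _ _).trans (mul_le_mul hdω
          (H.norm_le_hnorm _) (norm_nonneg _) hnf))
    calc ‖p‖ ^ 2 ≤ H.hnorm v * (2 * nf + ng) := by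
          rw [Submodule.coe_norm]
          linarith
      _ ≤ c * ‖p‖ * (2 * nf + ng) := by gcongr
      _ = _ := by ring
  have e1 : 0 ≤ c * nf := by positivity
  have e2 : 0 ≤ c * ng := by positivity
  have e3 : 0 ≤ c * nh := by positivity
  have e4 : 0 ≤ c ^ 2 * ng := by positivity
  have e5 : 0 ≤ c ^ 2 * nh := by positivity
  linarith

end IsStokesTriple

/-! ### Unique solvability in finite dimensions. -/

/-- The bilinear form of the mixed Stokes problem, with the trial functions in the first and the
test functions in the second argument. -/
noncomputable def stokesForm (W₀ : Submodule ℝ (H.HΛ m)) (V₀ : Submodule ℝ (H.HΛ (m + 1)))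
    (Q₀ : Submodule ℝ H.Q) : (W₀ × V₀ × Q₀) →ₗ[ℝ] (W₀ × V₀ × Q₀) →ₗ[ℝ] ℝ :=
  LinearMap.mk₂ ℝ
    (fun x y => (H.formA y.1 x.1 - H.formC y.1 x.2.1) +
      (H.formE y.2.1 x.2.1 + H.formC x.1 y.2.1 + H.formB y.2.1 x.2.2) + H.formB x.2.1 y.2.2)
    (fun x x' y => by
      simp only [formA, formB, formC, formE, Prod.fst_add, Prod.snd_add, Submodule.coe_add,
        LinearPMap.map_add, inner_add_left, inner_add_right]
      ring)
    (fun r x y => by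
      simp only [formA, formB, formC, formE, Prod.smul_fst, Prod.smul_snd, Submodule.coe_smul,
        LinearPMap.map_smul, real_inner_smul_left, real_inner_smul_right, smul_eq_mul]
      ring)
    (fun x y y' => by
      simp only [formA, formB, formC, formE, Prod.fst_add, Prod.snd_add, Submodule.coe_add,
        LinearPMap.map_add, inner_add_left, inner_add_right]
      ring)
    (fun r x y => by
      simp only [formA, formB, formC, formE, Prod.smul_fst, Prod.smul_snd, Submodule.coe_smul,
        LinearPMap.map_smul, real_inner_smul_left, real_inner_smul_right, smul_eq_mul]
      ring)

theorem stokesForm_apply {W₀ : Submodule ℝ (H.HΛ m)} {V₀ : Submodule ℝ (H.HΛ (m + 1))}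
    {Q₀ : Submodule ℝ H.Q} (x y : W₀ × V₀ × Q₀) :
    stokesForm W₀ V₀ Q₀ x y = (H.formA y.1 x.1 - H.formC y.1 x.2.1) +
      (H.formE y.2.1 x.2.1 + H.formC x.1 y.2.1 + H.formB y.2.1 x.2.2) + H.formB x.2.1 y.2.2 :=
  rfl

/-- Test triples with a single non-zero component recover the three equations from their sum. -/
theorem isStokesSolution_of_stokesForm {W₀ : Submodule ℝ (H.HΛ m)}
    {V₀ : Submodule ℝ (H.HΛ (m + 1))} {Q₀ : Submodule ℝ H.Q} {f : H.HΛ (m + 1) →ₗ[ℝ] ℝ}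
    {g : H.Q →ₗ[ℝ] ℝ} {h : H.HΛ m →ₗ[ℝ] ℝ} {x : W₀ × V₀ × Q₀}
    (hx : ∀ y : W₀ × V₀ × Q₀, stokesForm W₀ V₀ Q₀ x y = h y.1 + f y.2.1 + g y.2.2) :
    H.IsStokesSolution W₀ V₀ Q₀ f g h x.1 x.2.1 x.2.2 where
  mem_W := x.1.2
  mem_V := x.2.1.2
  mem_Q := x.2.2.2
  eq_h τ hτ := by
    have := hx (⟨τ, hτ⟩, 0, 0)
    rw [stokesForm_apply] at this
    simpa [formE, formC, formB] using this
  eq_f v hv := by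
    have := hx (0, ⟨v, hv⟩, 0)
    rw [stokesForm_apply] at this
    simpa [formA, formC, formB] using this
  eq_g q hq := by
    have := hx (0, 0, ⟨q, hq⟩)
    rw [stokesForm_apply] at this
    simpa [formA, formE, formC, formB] using this

theorem IsStokesSolution.sub {W₀ : Submodule ℝ (H.HΛ m)} {V₀ : Submodule ℝ (H.HΛ (m + 1))}
    {Q₀ : Submodule ℝ H.Q} {f f' : H.HΛ (m + 1) →ₗ[ℝ] ℝ} {g g' : H.Q →ₗ[ℝ] ℝ}
    {h h' : H.HΛ m →ₗ[ℝ] ℝ} {ω ω' : H.HΛ m} {u u' : H.HΛ (m + 1)} {p p' : H.Q}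
    (hs : H.IsStokesSolution W₀ V₀ Q₀ f g h ω u p)
    (hs' : H.IsStokesSolution W₀ V₀ Q₀ f' g' h' ω' u' p') :
    H.IsStokesSolution W₀ V₀ Q₀ (f - f') (g - g') (h - h') (ω - ω') (u - u') (p - p') where
  mem_W := W₀.sub_mem hs.mem_W hs'.mem_W
  mem_V := V₀.sub_mem hs.mem_V hs'.mem_V
  mem_Q := Q₀.sub_mem hs.mem_Q hs'.mem_Q
  eq_h τ hτ := by
    rw [LinearMap.sub_apply, ← hs.eq_h τ hτ, ← hs'.eq_h τ hτ]
    simp only [formA, formC, Submodule.coe_sub, inner_sub_right]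
    ring
  eq_f v hv := by
    rw [LinearMap.sub_apply, ← hs.eq_f v hv, ← hs'.eq_f v hv]
    simp only [formE, formB, formC, Submodule.coe_sub, LinearPMap.map_sub, inner_sub_right,
      inner_sub_left]
    ring
  eq_g q hq := by
    rw [LinearMap.sub_apply, ← hs.eq_g q hq, ← hs'.eq_g q hq]
    simp only [formB, LinearPMap.map_sub, inner_sub_left]

namespace IsStokesTriple

variable {W₀ : Submodule ℝ (H.HΛ m)} {V₀ : Submodule ℝ (H.HΛ (m + 1))} {Q₀ : Submodule ℝ H.Q}
  {c : ℝ}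

theorem eq_zero_of_isStokesSolution_zero (H₀ : H.IsStokesTriple W₀ V₀ Q₀ c) {ω : H.HΛ m}
    {u : H.HΛ (m + 1)} {p : H.Q} (hs : H.IsStokesSolution W₀ V₀ Q₀ 0 0 0 ω u p) :
    ω = 0 ∧ u = 0 ∧ p = 0 := by
  have := H₀.estimate le_rfl le_rfl le_rfl (by simp) (by simp) (by simp) hs
  have h1 := H.hnorm_nonneg ω
  have h2 := H.hnorm_nonneg u
  have h3 := norm_nonneg p
  exact ⟨H.eq_zero_of_hnorm_nonpos (by linarith), H.eq_zero_of_hnorm_nonpos (by linarith),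
    norm_le_zero_iff.1 (by linarith)⟩

theorem unique (H₀ : H.IsStokesTriple W₀ V₀ Q₀ c) {f : H.HΛ (m + 1) →ₗ[ℝ] ℝ}
    {g : H.Q →ₗ[ℝ] ℝ} {h : H.HΛ m →ₗ[ℝ] ℝ} {ω ω' : H.HΛ m} {u u' : H.HΛ (m + 1)} {p p' : H.Q}
    (hs : H.IsStokesSolution W₀ V₀ Q₀ f g h ω u p)
    (hs' : H.IsStokesSolution W₀ V₀ Q₀ f g h ω' u' p') : ω' = ω ∧ u' = u ∧ p' = p := by
  have := hs'.sub hs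
  simp only [sub_self] at this
  simpa only [sub_eq_zero] using H₀.eq_zero_of_isStokesSolution_zero this

theorem exists_isStokesSolution (H₀ : H.IsStokesTriple W₀ V₀ Q₀ c) [FiniteDimensional ℝ W₀]
    [FiniteDimensional ℝ V₀] [FiniteDimensional ℝ Q₀] (f : H.HΛ (m + 1) →ₗ[ℝ] ℝ)
    (g : H.Q →ₗ[ℝ] ℝ) (h : H.HΛ m →ₗ[ℝ] ℝ) :
    ∃ ω u p, H.IsStokesSolution W₀ V₀ Q₀ f g h ω u p := by
  have hker : LinearMap.ker (stokesForm W₀ V₀ Q₀) = ⊥ := by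
    refine LinearMap.ker_eq_bot'.2 fun x hx => ?_
    obtain ⟨h1, h2, h3⟩ := H₀.eq_zero_of_isStokesSolution_zero
      (isStokesSolution_of_stokesForm (f := 0) (g := 0) (h := 0) (x := x) (by simp [hx]))
    exact Prod.ext (Subtype.ext h1) (Prod.ext (Subtype.ext h2) (Subtype.ext h3))
  -- A finite-dimensional space and its dual have equal dimension, so uniqueness already gives a
  -- solution for every right-hand side.
  obtain ⟨x, hx⟩ := LinearMap.surjective_of_ker_eq_bot_dual _ hker
    ((h ∘ₗ W₀.subtype).coprod ((f ∘ₗ V₀.subtype).coprod (g ∘ₗ Q₀.subtype)))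
  exact ⟨_, _, _, isStokesSolution_of_stokesForm (x := x) fun y => by simp [hx, add_assoc]⟩

end IsStokesTriple

/-! ### Exactness of the continuous and discrete triples. -/

theorem op_mem_Q (v : H.HΛ (m + 1)) : H.op (m + 1) v ∈ H.Q :=
  Submodule.le_orthogonal_orthogonal _ ⟨v, rfl⟩

/-- $Q$ is the double orthogonal complement of the range of $d$, which is the range itself because
the range is closed. -/
theorem IsClosedComplex.exists_op_eq (hH : H.IsClosedComplex) (q : H.Q) :
    ∃ v : H.HΛ (m + 1), H.op (m + 1) v = (q : H.L2 (m + 2)) := by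
  have : CompleteSpace (LinearMap.range (H.op (m + 1)).toFun) :=
    IsClosed.completeSpace_coe (hs := hH (m + 1))
  have hq : (q : H.L2 (m + 2)) ∈ LinearMap.range (H.op (m + 1)).toFun := by
    rw [← Submodule.orthogonal_orthogonal (LinearMap.range (H.op (m + 1)).toFun)]
    exact q.2
  exact hq

theorem HasPoincareConst.isStokesTriple (hH : H.IsClosedComplex) (hE : H.ExactAtSucc m) {c : ℝ}
    (hc : 0 < c) (hP : H.HasPoincareConst c) : H.IsStokesTriple ⊤ ⊤ ⊤ c where
  pos := hc
  proj_W := inferInstance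
  proj_V := inferInstance
  poincare_W := hP.1
  poincare_V := hP.2
  d_mem _ _ := Submodule.mem_top
  exact_V v hv := (hE v hv.2).imp fun _ h => ⟨Submodule.mem_top, h⟩
  op_mem v _ := ⟨⟨_, op_mem_Q v⟩, Submodule.mem_top, rfl⟩
  exact_Q q _ := (hH.exists_op_eq q).imp fun _ h => ⟨Submodule.mem_top, h⟩

theorem Subcomplex.mem_Qh {S : H.Subcomplex} {q : H.Q} :
    q ∈ S.Qh ↔ ∃ a ∈ S.Λ (m + 2), (a : H.L2 (m + 2)) = q :=
  Iff.rfl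

instance Subcomplex.finiteDimensional_Qh (S : H.Subcomplex) : FiniteDimensional ℝ S.Qh := by
  have := S.finiteDimensional (m + 2)
  exact Module.Finite.of_injective
    (H.Q.subtype.restrict (p := S.Qh) (q := (S.Λ (m + 2)).map (H.HΛ (m + 2)).subtype)
      fun _ h => h)
    fun x y h => by
      have e := congrArg Subtype.val h
      exact Subtype.ext (Subtype.ext e)

/-- Potentials exist in the whole complex, and $\pi_h$ moves them into the subcomplex without
changing their derivatives, which are discrete. No bound on $\pi_h$ enters. -/
theorem Subcomplex.HasDiscretePoincare.isStokesTriple {S : H.Subcomplex}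
    (M : S.MimeticOperators) (hH : H.IsClosedComplex) (hE : H.ExactAtSucc m) {c : ℝ}
    (hc : 0 < c) (hP : S.HasDiscretePoincare c) : H.IsStokesTriple S.Wh S.Vh S.Qh c where
  pos := hc
  proj_W := inferInstance
  proj_V := inferInstance
  poincare_W := hP.1
  poincare_V := hP.2
  d_mem := S.d_mem m
  exact_V v hv := by
    obtain ⟨τ, hτ⟩ := hE v hv.2
    have hd : H.d m τ = v := Subtype.ext hτ
    exact ⟨M.proj m τ, M.proj_mem τ, (M.op_proj_eq (hd ▸ hv.1)).trans hτ⟩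
  op_mem v hv := ⟨⟨_, op_mem_Q v⟩, Subcomplex.mem_Qh.2 ⟨_, S.d_mem _ v hv, rfl⟩, rfl⟩
  exact_Q q hq := by
    obtain ⟨a, ha, haq⟩ := Subcomplex.mem_Qh.1 hq
    obtain ⟨v, hv⟩ := hH.exists_op_eq q
    have hd : H.d (m + 1) v = a := Subtype.ext (hv.trans haq.symm)
    exact ⟨M.proj _ v, M.proj_mem v, (M.op_proj_eq (hd ▸ ha)).trans hv⟩

/-! ### Choice of the constants and conclusion. -/

theorem StokesInfSup.mono {W₀ : Submodule ℝ (H.HΛ m)} {V₀ : Submodule ℝ (H.HΛ (m + 1))}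
    {Q₀ : Submodule ℝ H.Q} {α β γ ε α' β' γ' ε' : ℝ} (h : H.StokesInfSup W₀ V₀ Q₀ α β γ ε)
    (hα : α' ≤ α) (hβ : β' ≤ β) (hγ : γ' ≤ γ) (hε : ε' ≤ ε) :
    H.StokesInfSup W₀ V₀ Q₀ α' β' γ' ε' where
  coercive_a := (EReal.coe_le_coe_iff.2 hα).trans h.coercive_a
  coercive_a' := (EReal.coe_le_coe_iff.2 hα).trans h.coercive_a'
  infsup_b := (EReal.coe_le_coe_iff.2 hβ).trans h.infsup_b
  infsup_c := (EReal.coe_le_coe_iff.2 hγ).trans h.infsup_c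
  coercive_e := (EReal.coe_le_coe_iff.2 hε).trans h.coercive_e
  coercive_e' := (EReal.coe_le_coe_iff.2 hε).trans h.coercive_e'

theorem stokesWellPosed (hH : H.IsClosedComplex) (hE : H.ExactAtSucc m) :
    H.StokesWellPosed (fun _ => 1) (fun c => c⁻¹) (fun c => c⁻¹) (fun c => (c ^ 2)⁻¹)
      (fun c => c ^ 2 + 5 * c + 1) (fun _ => 1 / 2) (fun c => c⁻¹ / 2) (fun c => c⁻¹ / 2)
      (fun c => (c ^ 2)⁻¹ / 2) where
  exists_poincare := by
    obtain ⟨c₁, h₁⟩ := hH.exists_hasPoincare m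
    obtain ⟨c₂, h₂⟩ := hH.exists_hasPoincare (m + 1)
    -- One constant serves both degrees; the $1$ makes it positive.
    exact ⟨max 1 (max c₁ c₂), by positivity, h₁ _ (by simp), h₂ _ (by simp)⟩
  continuous_infSup c hc hP :=
    -- The triple gives the same constants as in the discrete case. Halving them makes the
    -- comparison with the discrete ones strict even for equal Poincaré constants.
    (hP.isStokesTriple hH hE hc).stokesInfSup.mono (by norm_num) (half_le_self (by positivity))
      (half_le_self (by positivity)) (half_le_self (by positivity))
  discrete_poincare _ M _ _ _ hC hP hM := ⟨M.hasPoincare hC hP.1 hM, M.hasPoincare hC hP.2 hM⟩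
  discrete_infSup _ hM _ hc hP :=
    (Subcomplex.HasDiscretePoincare.isStokesTriple hM.some hH hE hc hP).stokesInfSup
  discrete_solvable S hM c hc hP f g h nf ng nh hnf hng hnh hf hg hh := by
    have H₀ := Subcomplex.HasDiscretePoincare.isStokesTriple hM.some hH hE hc hP
    have := S.finiteDimensional m
    have := S.finiteDimensional (m + 1)
    obtain ⟨ω, u, p, hs⟩ := H₀.exists_isStokesSolution f g h
    exact ⟨ω, u, p, hs, fun _ _ _ hs' => H₀.unique hs hs',
      H₀.estimate hnf hng hnh (fun v _ => hf v) (fun q _ => hg q) (fun τ _ => hh τ) hs⟩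

end HilbertComplex

theorem theorem4p5 :
    ∃ αh βh γh εh Kh α β γ ε : ℝ → ℝ,
      (∀ c, 0 < c → 0 < αh c ∧ 0 < βh c ∧ 0 < γh c ∧ 0 < εh c ∧ 0 < Kh c) ∧
      (∀ c, 0 < c → 0 < α c ∧ 0 < β c ∧ 0 < γ c ∧ 0 < ε c) ∧
      (∀ c₀ c, 0 < c → c ≤ c₀ → α c₀ < αh c ∧ β c₀ < βh c ∧ γ c₀ < γh c ∧ ε c₀ < εh c) ∧
      (∀ (m : ℕ) (H : HilbertComplex.{u} (m + 2)),
        H.IsClosedComplex → H.ExactAtSucc m →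
        H.StokesWellPosed αh βh γh εh Kh α β γ ε) ∧
      (∀ (m : ℕ) (Ω : Set (EuclideanSpace ℝ (Fin (m + 2)))) (hΩ : IsOpen Ω)
        (Γ : ℕ → Set (EuclideanSpace ℝ (Fin (m + 2)))) (hΓ : Antitone Γ),
        (deRhamComplex (m + 2) Ω hΩ Γ hΓ).IsClosedComplex →
        (deRhamComplex (m + 2) Ω hΩ Γ hΓ).ExactAtSucc m →
        (deRhamComplex (m + 2) Ω hΩ Γ hΓ).StokesWellPosed αh βh γh εh Kh α β γ ε) := by
  refine ⟨fun _ => 1, fun c => c⁻¹, fun c => c⁻¹, fun c => (c ^ 2)⁻¹, fun c => c ^ 2 + 5 * c + 1,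
    fun _ => 1 / 2, fun c => c⁻¹ / 2, fun c => c⁻¹ / 2, fun c => (c ^ 2)⁻¹ / 2, ?_, ?_, ?_,
    fun m H hH hE => HilbertComplex.stokesWellPosed hH hE,
    fun m Ω hΩ Γ hΓ hH hE => HilbertComplex.stokesWellPosed hH hE⟩
  · intro c hc
    exact ⟨one_pos, by positivity, by positivity, by positivity, by positivity⟩
  · intro c hc
    exact ⟨by norm_num, by positivity, by positivity, by positivity⟩
  · intro c₀ c hc hle
    have hc₀ : 0 < c₀ := hc.trans_le hle
    have h1 : c₀⁻¹ / 2 < c⁻¹ := (half_lt_self (by positivity)).trans_le (by gcongr)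
    exact ⟨by norm_num, h1, h1, (half_lt_self (by positivity)).trans_le
      (inv_anti₀ (by positivity) (pow_le_pow_left₀ hc.le hle 2))⟩
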